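/- Let $K$ be a field. A *Brauer configuration* $\Gamma=(\Gamma_0,\Gamma_1,\mu,\mathfrak o)$ consists of a finite set $\Gamma_0$ of vertices, a finite set $\Gamma_1$ of labelled finite multisets of vertices (polygons), a function $\mu\colon\Gamma_0\to\mathbb Z_{>0}$, and, for each $\alpha\in\Gamma_0$, a cyclic ordering of the list of polygons containing $\alpha$, where a polygon $V$ is listed $\operatorname{occ}(\alpha,V)$ times, the number of times that $\alpha$ occurs in $V$. Put $\operatorname{val}(\alpha)=\sum_{V}\operatorname{occ}(\alpha,V)$. It is required that every vertex lies in some polygon, that every polygon has at least two vertices (counted with repetitions), and that every polygon contains a vertex $\alpha$ with $\operatorname{val}(\alpha)\mu(\alpha)>1$. A vertex $\alpha$ is *truncated* if $\operatorname{val}(\alpha)\mu(\alpha)=1$. Assume that $\Gamma$ is *reduced*: a polygon containing a truncated vertex is a $2$-gon. The quiver $\mathcal Q$ of $\Gamma$ has one vertex $v$ for each polygon $V$ and, for each nontruncated $\alpha$ and each entry $V$ of the cyclically ordered list at $\alpha$, with successor $V'$ in that list, an arrow $v\to v'$. For each occurrence of a nontruncated vertex $\alpha$ in $V$, the *special $\alpha$-cycle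 at $v$* is the cycle $C=a_1a_2\cdots a_{\operatorname{val}(\alpha)}$ that starts at $v$ and runs once around the list at $\alpha$, starting from the corresponding entry. Paths are written from left to right. The Brauer configuration algebra is $\Lambda=K\mathcal Q/I$, where $I$ is the two-sided ideal generated by 1. all $C^{\mu(\alpha)}-C'^{\mu(\beta)}$, for a special $\alpha$-cycle $C$ and a special $\beta$-cycle $C'$ at the same vertex $v$; 2. all $C^{\mu(\alpha)}a$, for a special $\alpha$-cycle $C$ with first arrow $a$; 3. all paths $ab$ of length two that are not a subpath of a special cycle, except $aa$ where $a$ is the loop at a nontruncated vertex $\alpha$ with $\operatorname{val}(\alpha)=1$. Modules are right $\Lambda$-modules. Write $\bar x$ for the residue class of $x$ in $\Lambda$, let $e_v$ be the idempotent at $v$, and put $P_V=e_v\Lambda$. For a special $\alpha$-cycle $C$ at $v$ let $U_1(C)=\bar a_1\Lambda\subseteq P_V$, where $a_1$ is the first arrow of $C$. A module is uniserial if its submodules form a chain. **Theorem.** (a) Each $P_V$ is an indecomposable projective $\Lambda$-module, and $V\mapsto P_V$ induces a bijection from $\Gamma_1$ to the set of isomorphism classes of indecomposable projective $\Lambda$-modules.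 (b) Let $V$ be a $d$-gon ($d$ counts vertices with repetitions) and $P=P_V$. If no vertex of $V$ is truncated, put $r=d$; otherwise $V$ is a $2$-gon, and we put $r=1$. Then there are exactly $r$ special $\alpha$-cycles $C$ at $v$ with $\alpha$ a nontruncated vertex of $V$ (one for each occurrence of a nontruncated vertex in $V$). For each of them, $U_1(C)$ is uniserial, and its $K$-basis consists of the residue classes of the prefixes of lengths $1,2,\dots,\operatorname{val}(\alpha)\mu(\alpha)$ of $C^{\mu(\alpha)}$. Moreover $$\operatorname{rad}(P)=\sum_C U_1(C),$$ the socle of $P$ is simple and contained in $\operatorname{rad}(P)$, and $U_1(C)\cap U_1(C')=\operatorname{soc}(P)$ whenever $C\neq C'$. The heart $\operatorname{rad}(P)/\operatorname{soc}(P)$ is the direct sum of the images of the modules $U_1(C)$, and these $r$ images are nonzero and uniserial. -/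

import Mathlib

universe u

/-! ### Module-theoretic notions -/

/-- A module is uniserial if its submodules form a chain. -/
def IsUniserial (R M : Type*) [Ring R] [AddCommGroup M] [Module R M] : Prop :=
  ∀ A B : Submodule R M, A ≤ B ∨ B ≤ A

/-- A module is indecomposable if it is nonzero and is not the direct sum of two nonzero
submodules. -/
def IsIndecomposableModule (R M : Type*) [Ring R] [AddCommGroup M] [Module R M] : Prop :=
  Nontrivial M ∧ ∀ A B : Submodule R M, IsCompl A B → A = ⊥ ∨ B = ⊥

/-- The socle of a module: the sum of its simple submodules. -/
def moduleSocle (R M : Type*) [Ring R] [AddCommGroup M] [Module R M] : Submodule R M :=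
  sSup {S : Submodule R M | IsSimpleModule R S}

/-- The heart `rad M / soc M` of a module (used when `soc M ≤ rad M`); the radical
`Module.jacobson R M` is the intersection of the maximal submodules. -/
abbrev ModuleHeart (R M : Type*) [Ring R] [AddCommGroup M] [Module R M] : Type _ :=
  ↥(Module.jacobson R M) ⧸ (moduleSocle R M).submoduleOf (Module.jacobson R M)

/-- The image in the heart of a submodule `N` of `M` (used when `N ≤ rad M`), that is,
`(N + soc M) / soc M`. -/
def heartImage (R : Type*) {M : Type*} [Ring R] [AddCommGroup M] [Module R M]
    (N : Submodule R M) : Submodule R (ModuleHeart R M) :=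
  (N.submoduleOf (Module.jacobson R M)).map
    ((moduleSocle R M).submoduleOf (Module.jacobson R M)).mkQ

/-! ### Path algebras -/

/-- All paths of a quiver, including the trivial ones, with their start and end points. -/
abbrev AnyPath (Q : Type*) [Quiver Q] : Type _ := Σ a b : Q, Quiver.Path a b

/-- The path algebra `KQ`: the vector space with basis the paths of `Q`. -/
def PathAlgebra (K Q : Type*) [Field K] [Quiver Q] : Type _ := AnyPath Q →₀ K

namespace PathAlgebra

variable {K Q : Type*} [Field K] [Quiver Q]

noncomputable instance : AddCommGroup (PathAlgebra K Q) :=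
  inferInstanceAs (AddCommGroup (AnyPath Q →₀ K))

noncomputable instance : Module K (PathAlgebra K Q) :=
  inferInstanceAs (Module K (AnyPath Q →₀ K))

/-- A path, as a basis element of the path algebra. -/
noncomputable def ofPath (K : Type*) {Q : Type*} [Field K] [Quiver Q] {a b : Q}
    (p : Quiver.Path a b) : PathAlgebra K Q :=
  Finsupp.single (⟨a, b, p⟩ : AnyPath Q) (1 : K)

open Classical in
/-- The product of two paths: their concatenation (first `p`, then `q`) if `p` ends where `q`
starts, and zero otherwise. -/
noncomputable def pathMul (K : Type*) {Q : Type*} [Field K] [Quiver Q] (p q : AnyPath Q) :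
    PathAlgebra K Q :=
  if h : p.2.1 = q.1 then ofPath K (p.2.2.comp (q.2.2.cast h.symm rfl)) else 0

/-- The bilinear extension of the product of paths. -/
noncomputable def mulBilin (K Q : Type*) [Field K] [Quiver Q] :
    PathAlgebra K Q →ₗ[K] PathAlgebra K Q →ₗ[K] PathAlgebra K Q :=
  Finsupp.linearCombination K fun p => Finsupp.linearCombination K fun q => pathMul K p q

noncomputable instance : Mul (PathAlgebra K Q) := ⟨fun x y => mulBilin K Q x y⟩

theorem mul_def (x y : PathAlgebra K Q) : x * y = mulBilin K Q x y := rfl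

theorem mulBilin_ofPath {a b c d : Q} (p : Quiver.Path a b) (q : Quiver.Path c d) :
    mulBilin K Q (ofPath K p) (ofPath K q) = pathMul K ⟨a, b, p⟩ ⟨c, d, q⟩ := by
  unfold mulBilin ofPath
  erw [Finsupp.linearCombination_single, one_smul, Finsupp.linearCombination_single, one_smul]

theorem ofPath_mul_ofPath {a b c : Q} (p : Quiver.Path a b) (q : Quiver.Path b c) :
    ofPath K p * ofPath K q = ofPath K (p.comp q) := by
  rw [mul_def, mulBilin_ofPath]
  simp [pathMul]

theorem ofPath_mul_ofPath_of_ne {a b c d : Q} (p : Quiver.Path a b) (q : Quiver.Path c d)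
    (h : b ≠ c) : ofPath K p * ofPath K q = 0 := by
  rw [mul_def, mulBilin_ofPath]
  simp [pathMul, h]

/-- Linear maps on the path algebra that agree on all paths are equal. -/
theorem hom_ext {M : Type*} [AddCommGroup M] [Module K M] {f g : PathAlgebra K Q →ₗ[K] M}
    (h : ∀ (a b : Q) (p : Quiver.Path a b), f (ofPath K p) = g (ofPath K p)) : f = g :=
  Finsupp.lhom_ext' fun p => LinearMap.ext_ring (h p.1 p.2.1 p.2.2)

theorem ofPath_mul_assoc {a b c d e f : Q} (p : Quiver.Path a b) (q : Quiver.Path c d)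
    (r : Quiver.Path e f) :
    ofPath K p * ofPath K q * ofPath K r = ofPath K p * (ofPath K q * ofPath K r) := by
  by_cases h1 : b = c
  · subst h1
    by_cases h2 : d = e
    · subst h2
      simp only [ofPath_mul_ofPath, Quiver.Path.comp_assoc]
    · rw [ofPath_mul_ofPath, ofPath_mul_ofPath_of_ne _ _ h2, ofPath_mul_ofPath_of_ne _ _ h2,
        mul_def, map_zero]
  · rw [ofPath_mul_ofPath_of_ne _ _ h1]
    by_cases h2 : d = e
    · subst h2
      rw [ofPath_mul_ofPath, ofPath_mul_ofPath_of_ne _ _ h1, mul_def, map_zero,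
        LinearMap.zero_apply]
    · rw [ofPath_mul_ofPath_of_ne _ _ h2, mul_def, mul_def, map_zero, map_zero,
        LinearMap.zero_apply]

theorem mul_assoc_aux (x y z : PathAlgebra K Q) : x * y * z = x * (y * z) := by
  have h1 : ∀ {a b c d : Q} (p : Quiver.Path a b) (q : Quiver.Path c d) (z : PathAlgebra K Q),
      ofPath K p * ofPath K q * z = ofPath K p * (ofPath K q * z) := fun p q z =>
    LinearMap.congr_fun (f := mulBilin K Q (ofPath K p * ofPath K q))
      (g := (mulBilin K Q (ofPath K p)).comp (mulBilin K Q (ofPath K q)))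
      (hom_ext fun _ _ r => ofPath_mul_assoc p q r) z
  have h2 : ∀ {a b : Q} (p : Quiver.Path a b) (y z : PathAlgebra K Q),
      ofPath K p * y * z = ofPath K p * (y * z) := fun p y z =>
    LinearMap.congr_fun
      (f := ((mulBilin K Q).flip z).comp (mulBilin K Q (ofPath K p)))
      (g := (mulBilin K Q (ofPath K p)).comp ((mulBilin K Q).flip z))
      (hom_ext fun _ _ q => h1 p q z) y
  exact LinearMap.congr_fun
    (f := ((mulBilin K Q).flip z).comp ((mulBilin K Q).flip y))
    (g := (mulBilin K Q).flip (y * z))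
    (hom_ext fun _ _ p => h2 p y z) x

variable [Fintype Q]

/-- The unit of the path algebra of a quiver with finitely many vertices: the sum of the trivial
paths. -/
noncomputable instance : One (PathAlgebra K Q) :=
  ⟨∑ v : Q, ofPath K (Quiver.Path.nil : Quiver.Path v v)⟩

theorem one_def :
    (1 : PathAlgebra K Q) = ∑ v : Q, ofPath K (Quiver.Path.nil : Quiver.Path v v) := rfl

theorem one_mul_aux (x : PathAlgebra K Q) : 1 * x = x := by
  refine LinearMap.congr_fun (f := mulBilin K Q 1) (g := LinearMap.id) (hom_ext fun a b p => ?_) x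
  rw [one_def, map_sum, LinearMap.sum_apply, LinearMap.id_apply, Finset.sum_eq_single a]
  · rw [← mul_def, ofPath_mul_ofPath, Quiver.Path.nil_comp]
  · intro c _ hc
    rw [← mul_def, ofPath_mul_ofPath_of_ne _ _ hc]
  · intro h
    exact absurd (Finset.mem_univ a) h

theorem mul_one_aux (x : PathAlgebra K Q) : x * 1 = x := by
  refine LinearMap.congr_fun (f := (mulBilin K Q).flip 1) (g := LinearMap.id)
    (hom_ext fun a b p => ?_) x
  rw [LinearMap.flip_apply, one_def, map_sum, LinearMap.id_apply, Finset.sum_eq_single b]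
  · rw [← mul_def, ofPath_mul_ofPath, Quiver.Path.comp_nil]
  · intro c _ hc
    rw [← mul_def, ofPath_mul_ofPath_of_ne _ _ hc.symm]
  · intro h
    exact absurd (Finset.mem_univ b) h

noncomputable instance : Ring (PathAlgebra K Q) :=
  { (inferInstance : AddCommGroup (PathAlgebra K Q)) with
    mul := (· * ·)
    one := 1
    mul_assoc := mul_assoc_aux
    one_mul := one_mul_aux
    mul_one := mul_one_aux
    left_distrib := fun x y z => map_add (mulBilin K Q x) y z
    right_distrib := fun x y z => LinearMap.map_add₂ (mulBilin K Q) x y z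
    zero_mul := fun x => LinearMap.map_zero₂ (mulBilin K Q) x
    mul_zero := fun x => map_zero (mulBilin K Q x) }

noncomputable instance : Algebra K (PathAlgebra K Q) :=
  Algebra.ofModule (fun c x y => LinearMap.map_smul₂ (mulBilin K Q) c x y)
    (fun c x y => map_smul (mulBilin K Q x) c y)

end PathAlgebra

/-- A path `q` is a subpath of a path `p`. -/
def IsSubpath {Q : Type*} [Quiver Q] {a b c d : Q} (q : Quiver.Path b c) (p : Quiver.Path a d) :
    Prop :=
  ∃ (r : Quiver.Path a b) (s : Quiver.Path c d), p = (r.comp q).comp s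

/-! ### Brauer configurations -/

/-- A Brauer configuration with vertex set `Γ₀` and a set `Γ₁` of (labels of) polygons.
For a vertex `α`, the type `Σ V, Fin ((polygon V).count α)` is the list of the polygons in which
`α` occurs, each polygon `V` being listed as many times as `α` occurs in it.  A cyclic ordering of
this list is given by its successor function, a permutation with a single orbit. -/
structure BrauerConfiguration (Γ₀ Γ₁ : Type*) [DecidableEq Γ₀] [Fintype Γ₁] where
  /-- the multiset of vertices of a polygon -/
  polygon : Γ₁ → Multiset Γ₀
  /-- the multiplicity function -/
  mult : Γ₀ → ℕ
  mult_pos : ∀ α, 0 < mult α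
  /-- the orientation: the successor function of the cyclic ordering at each vertex -/
  next : ∀ α : Γ₀, Equiv.Perm (Σ V : Γ₁, Fin ((polygon V).count α))
  next_isCycleOn : ∀ α, (next α).IsCycleOn Set.univ
  exists_mem_polygon : ∀ α, ∃ V, α ∈ polygon V
  two_le_card : ∀ V, 2 ≤ (polygon V).card
  exists_one_lt : ∀ V, ∃ α ∈ polygon V, 1 < (∑ W, (polygon W).count α) * mult α

namespace BrauerConfiguration

variable {Γ₀ Γ₁ : Type*} [DecidableEq Γ₀] [Fintype Γ₁]

section Combinatorics

variable (Γ : BrauerConfiguration Γ₀ Γ₁)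

/-- The valence of a vertex: the total number of its occurrences in polygons. -/
def val (α : Γ₀) : ℕ := ∑ V, (Γ.polygon V).count α

/-- A vertex is truncated if it occurs exactly once in exactly one polygon and has
multiplicity one. -/
def IsTruncated (α : Γ₀) : Prop := Γ.val α * Γ.mult α = 1

/-- A Brauer configuration is reduced if no truncated vertex can be removed, that is, no polygon
with at least three vertices contains a truncated vertex. -/
def IsReduced : Prop :=
  ∀ V, ∀ α ∈ Γ.polygon V, Γ.IsTruncated α → (Γ.polygon V).card = 2

/-- The list of polygons at `α`, with repetitions. -/
abbrev Occ (α : Γ₀) : Type _ := Σ V : Γ₁, Fin ((Γ.polygon V).count α)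

/-- The nontruncated vertices. -/
abbrev Nontruncated : Type _ := {α : Γ₀ // ¬ Γ.IsTruncated α}

/-- The vertex set of the quiver of `Γ`: one vertex for every polygon. -/
def QuiverVertex (_Γ : BrauerConfiguration Γ₀ Γ₁) : Type _ := Γ₁

/-- The quiver vertex `v` associated to a polygon `V`. -/
def vtx (V : Γ₁) : Γ.QuiverVertex := V

instance : Fintype Γ.QuiverVertex := inferInstanceAs (Fintype Γ₁)

/-- The arrows of the quiver of `Γ`: one arrow for every nontruncated vertex `α` and every member
`x` of the list of polygons at `α`, going from the polygon at `x` to the polygon at the successor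
of `x`. -/
abbrev Arrow : Type _ := Σ α : Γ.Nontruncated, Γ.Occ α.1

variable {Γ} in
/-- The start of an arrow. -/
def Arrow.source (a : Γ.Arrow) : Γ.QuiverVertex := Γ.vtx a.2.1

variable {Γ} in
/-- The end of an arrow. -/
def Arrow.target (a : Γ.Arrow) : Γ.QuiverVertex := Γ.vtx (Γ.next a.1 a.2).1

/-- The quiver of `Γ`. -/
instance : Quiver Γ.QuiverVertex where
  Hom v w := {a : Γ.Arrow // a.source = v ∧ a.target = w}

variable {Γ} in
/-- An arrow as a morphism of the quiver. -/
def Arrow.toHom (a : Γ.Arrow) : a.source ⟶ a.target := ⟨a, rfl, rfl⟩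

/-- The special `α`-cycles at the quiver vertex of `V`, for all nontruncated `α`: there is one for
every occurrence of a nontruncated vertex `α` in `V`. -/
abbrev SpecialCycle (V : Γ₁) : Type _ := Σ α : Γ.Nontruncated, Fin ((Γ.polygon V).count α.1)

variable {Γ}

namespace SpecialCycle

variable {V : Γ₁}

/-- The vertex `α` of which this is a special `α`-cycle. -/
def vertex (C : Γ.SpecialCycle V) : Γ₀ := C.1

/-- The entry reached from the starting point of the cycle after `n` steps in the cyclic
ordering at `α`. -/
def entry (C : Γ.SpecialCycle V) (n : ℕ) : Γ.Occ C.1 := (Γ.next C.1)^[n] ⟨V, C.2⟩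

/-- The `n`-th arrow (counted from `0`) met when running around the cycle. -/
def arrow (C : Γ.SpecialCycle V) (n : ℕ) : Γ.Arrow := ⟨C.1, C.entry n⟩

theorem arrow_target (C : Γ.SpecialCycle V) (n : ℕ) :
    (C.arrow n).target = (C.arrow (n + 1)).source :=
  congrArg (fun x : Γ.Occ C.1 => Γ.vtx x.1)
    (Function.iterate_succ_apply' (Γ.next C.1) n ⟨V, C.2⟩).symm

/-- The path consisting of the first `n` arrows met when running (repeatedly) around the cycle. -/
def walk (C : Γ.SpecialCycle V) :
    ∀ n : ℕ, Quiver.Path (Γ.vtx V) (C.arrow n).source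
  | 0 => Quiver.Path.nil
  | n + 1 => (C.walk n).cons ⟨C.arrow n, rfl, C.arrow_target n⟩

/-- The special cycle itself, `a₁ a₂ ⋯ aₙ` with `n = val α`. -/
def path (C : Γ.SpecialCycle V) :
    Quiver.Path (Γ.vtx V) (C.arrow (Γ.val C.vertex)).source :=
  C.walk (Γ.val C.vertex)

end SpecialCycle

end Combinatorics

/-! ### Brauer configuration algebras -/

section Algebra

variable (K : Type*) [Field K] (Γ : BrauerConfiguration Γ₀ Γ₁)

/-- The power `C ^ μ(α)` of a special `α`-cycle, in the path algebra. -/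
noncomputable def cyclePow {V : Γ₁} (C : Γ.SpecialCycle V) : PathAlgebra K Γ.QuiverVertex :=
  PathAlgebra.ofPath K C.path ^ Γ.mult C.vertex

/-- Relations of type one: differences `C ^ μ(α) - C' ^ μ(β)` for a special `α`-cycle `C` and a
special `β`-cycle `C'` at the same quiver vertex. -/
def relationsOne : Set (PathAlgebra K Γ.QuiverVertex) :=
  {z | ∃ (V : Γ₁) (C C' : Γ.SpecialCycle V), z = Γ.cyclePow K C - Γ.cyclePow K C'}

/-- Relations of type two: `C ^ μ(α) a` for a special `α`-cycle `C` with first arrow `a`. -/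
def relationsTwo : Set (PathAlgebra K Γ.QuiverVertex) :=
  {z | ∃ (V : Γ₁) (C : Γ.SpecialCycle V),
    z = Γ.cyclePow K C * PathAlgebra.ofPath K (C.arrow 0).toHom.toPath}

/-- Relations of type three: paths `a b` of length two that are not a subpath of any special
cycle, unless `a = b` is the loop of a vertex of valence one. -/
def relationsThree : Set (PathAlgebra K Γ.QuiverVertex) :=
  {z | ∃ (u v w : Γ.QuiverVertex) (a : u ⟶ v) (b : v ⟶ w),
    (∀ (V : Γ₁) (C : Γ.SpecialCycle V), ¬ IsSubpath (a.toPath.comp b.toPath) C.path) ∧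
    ¬ (a.1 = b.1 ∧ Γ.val a.1.1 = 1) ∧
    z = PathAlgebra.ofPath K (a.toPath.comp b.toPath)}

/-- The ideal of relations. -/
noncomputable def relationIdeal : TwoSidedIdeal (PathAlgebra K Γ.QuiverVertex) :=
  TwoSidedIdeal.span (Γ.relationsOne K ∪ Γ.relationsTwo K ∪ Γ.relationsThree K)

/-- The Brauer configuration algebra: the path algebra modulo the ideal of relations. -/
abbrev BCAlgebra : Type _ := (Γ.relationIdeal K).ringCon.Quotient

/-- The residue class in the Brauer configuration algebra of an element of the path algebra. -/
noncomputable def toBCAlgebra : PathAlgebra K Γ.QuiverVertex →+* Γ.BCAlgebra K :=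
  (Γ.relationIdeal K).ringCon.mk'

/-- The idempotent `e_v` at the quiver vertex `v` of a polygon `V`. -/
noncomputable def idem (V : Γ₁) : Γ.BCAlgebra K :=
  Γ.toBCAlgebra K
    (PathAlgebra.ofPath K (Quiver.Path.nil : Quiver.Path (Γ.vtx V) (Γ.vtx V)))

/-- The projective right module `P_V = e_v Λ`. Right modules over `Λ` are modules over the
opposite ring of `Λ`. -/
noncomputable def proj (V : Γ₁) : Submodule (Γ.BCAlgebra K)ᵐᵒᵖ (Γ.BCAlgebra K) :=
  Submodule.span _ {Γ.idem K V}

theorem toBCAlgebra_walk_mem_proj {V : Γ₁} (C : Γ.SpecialCycle V) (n : ℕ) :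
    Γ.toBCAlgebra K (PathAlgebra.ofPath K (C.walk n)) ∈ Γ.proj K V := by
  refine Submodule.mem_span_singleton.2
    ⟨MulOpposite.op (Γ.toBCAlgebra K (PathAlgebra.ofPath K (C.walk n))), ?_⟩
  rw [op_smul_eq_mul, idem, ← map_mul, PathAlgebra.ofPath_mul_ofPath,
    Quiver.Path.nil_comp]

/-- The residue class in `P_V` of the path formed by the first `n` arrows of a power of the
special cycle `C` at `v`. -/
noncomputable def prefixElt {V : Γ₁} (C : Γ.SpecialCycle V) (n : ℕ) : Γ.proj K V :=
  ⟨Γ.toBCAlgebra K (PathAlgebra.ofPath K (C.walk n)), Γ.toBCAlgebra_walk_mem_proj K C n⟩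

/-- The submodule `U_j(C)` of `P_V`, generated by the prefix of length `j` of `C ^ μ(α)`, for
`1 ≤ j ≤ val(α) μ(α)`. -/
noncomputable def uniserialSubmodule {V : Γ₁} (C : Γ.SpecialCycle V) (j : ℕ) :
    Submodule (Γ.BCAlgebra K)ᵐᵒᵖ (Γ.proj K V) :=
  Submodule.span _ {Γ.prefixElt K C j}

end Algebra

end BrauerConfiguration

/-! Two facts about the algebra carry everything: few paths survive, and the survivors are
independent. For the first, relations of type three force a nonzero path of positive length to pass
from each arrow `a` to `a.succ`, so it runs around one special cycle. Type two bounds its length by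
`total`, and type one merges the maximal walks at a polygon into one element `top`. Hence
idempotents and walks span (`linear_induction`).

Independence comes from a linear form: `pathTrace` is one on maximal powers of special cycles and
zero on all other paths. It vanishes on the ideal of relations (`pathTrace_relationIdeal`), so it
descends to `trace`. A walk times its complement `dualElt` is a maximal walk, so pairing with dual
walks reads off coefficients of walks; pairing with `top` reads off coefficients of idempotents.

Every element acts on `top` by a scalar, so the functionals `coeffIdem` are characters. Their common
kernel is the nilpotent arrow ideal. Thus each P_V has a unique maximal submodule, which gives its
radical and its indecomposability. Nilpotency also gives every nonzero projective module a
functional not landing in the arrow ideal; from it an indecomposable projective acquires a split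
surjection onto some P_V.

Inside P_V, every multiple of an arrow is a walk times a unit, so U_1(C) is uniserial. By nilpotency
every nonzero submodule contains a nonzero element killed by the arrow ideal; dual walks show that
it is a multiple of `top`, so the socle is simple. The nontrivial dual walks of C kill the socle and
have zero trace against the other U_1(C'), which yields the intersections and the decomposition of
the heart. -/

namespace BrauerConfiguration

variable {Γ₀ Γ₁ : Type*} [DecidableEq Γ₀] [Fintype Γ₁] {Γ : BrauerConfiguration Γ₀ Γ₁}

/-! ### Arrows and their successors -/

/-- The arrow that follows a given arrow in the special cycles through it. -/
def Arrow.succ (a : Γ.Arrow) : Γ.Arrow := ⟨a.1, Γ.next a.1 a.2⟩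

/-- The special cycle whose first arrow is the given arrow. -/
def Arrow.cycle (a : Γ.Arrow) : Γ.SpecialCycle a.2.1 := ⟨a.1, a.2.2⟩

/-- The length `val α * μ α` of the maximal nonzero paths around the vertex of an arrow. -/
def Arrow.total (a : Γ.Arrow) : ℕ := Γ.val a.1.1 * Γ.mult a.1.1

theorem Arrow.succ_iterate (a : Γ.Arrow) (n : ℕ) :
    Arrow.succ^[n] a = ⟨a.1, (Γ.next a.1)^[n] a.2⟩ := by
  induction n with
  | zero => rfl
  | succ n ih => rw [Function.iterate_succ_apply', Function.iterate_succ_apply', ih]; rfl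

theorem SpecialCycle.arrow_eq_iterate {V : Γ₁} (C : Γ.SpecialCycle V) (n : ℕ) :
    C.arrow n = Arrow.succ^[n] (C.arrow 0) := by
  rw [Arrow.succ_iterate]; rfl

theorem Arrow.cycle_arrow (a : Γ.Arrow) (n : ℕ) : a.cycle.arrow n = Arrow.succ^[n] a :=
  a.cycle.arrow_eq_iterate n

theorem Arrow.total_iterate (a : Γ.Arrow) (n : ℕ) : (Arrow.succ^[n] a).total = a.total := by
  rw [succ_iterate]; rfl

theorem Arrow.succ_injective : Function.Injective (Arrow.succ : Γ.Arrow → Γ.Arrow) := by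
  rintro ⟨α, x⟩ ⟨β, y⟩ h
  have h1 : α = β := congrArg Sigma.fst h
  subst h1
  have h2 : Γ.next α x = Γ.next α y := eq_of_heq (Sigma.mk.inj h).2
  rw [(Γ.next α).injective h2]

theorem card_occ (α : Γ₀) : Fintype.card (Γ.Occ α) = Γ.val α := by
  simp [Fintype.card_sigma, val]

theorem next_iterate_val (α : Γ₀) (x : Γ.Occ α) : (Γ.next α)^[Γ.val α] x = x := by
  have h : (Γ.next α).IsCycleOn ((Finset.univ : Finset (Γ.Occ α)) : Set (Γ.Occ α)) := by
    simpa using Γ.next_isCycleOn α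
  have := h.pow_card_apply (Finset.mem_univ x)
  rwa [Finset.card_univ, card_occ, ← Equiv.Perm.iterate_eq_pow] at this

theorem Arrow.succ_iterate_val_mul (a : Γ.Arrow) (k : ℕ) :
    Arrow.succ^[Γ.val a.1.1 * k] a = a := by
  rw [Function.iterate_mul]
  refine Function.iterate_fixed ?_ k
  rw [succ_iterate, next_iterate_val]

theorem Arrow.succ_iterate_total (a : Γ.Arrow) : Arrow.succ^[a.total] a = a :=
  a.succ_iterate_val_mul _

theorem val_pos (α : Γ₀) : 0 < Γ.val α := by
  obtain ⟨V, hV⟩ := Γ.exists_mem_polygon α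
  exact lt_of_lt_of_le (Multiset.count_pos.2 hV)
    (Finset.single_le_sum (f := fun V => (Γ.polygon V).count α) (fun _ _ => Nat.zero_le _)
      (Finset.mem_univ V))

theorem Arrow.two_le_total (a : Γ.Arrow) : 2 ≤ a.total := by
  have h1 : 0 < a.total := Nat.mul_pos (val_pos _) (Γ.mult_pos _)
  have h2 : a.total ≠ 1 := a.1.2
  omega

theorem Arrow.total_pos (a : Γ.Arrow) : 0 < a.total := lt_of_lt_of_le two_pos a.two_le_total

theorem Arrow.succ_eq_self_of_val_eq_one (a : Γ.Arrow) (h : Γ.val a.1.1 = 1) : a.succ = a := by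
  simpa [h] using a.succ_iterate_val_mul 1

theorem finite_vertices (Γ : BrauerConfiguration Γ₀ Γ₁) : Finite Γ₀ := by
  rw [← Set.finite_univ_iff]
  refine (Set.finite_iUnion fun V : Γ₁ => (Γ.polygon V).toFinset.finite_toSet).subset ?_
  intro α _
  obtain ⟨V, hV⟩ := Γ.exists_mem_polygon α
  exact Set.mem_iUnion.2 ⟨V, by simpa using hV⟩

instance : Finite Γ.Arrow := by
  have := Γ.finite_vertices
  infer_instance

instance (V : Γ₁) : Finite (Γ.SpecialCycle V) := by
  have := Γ.finite_vertices
  infer_instance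

theorem exists_arrow (Γ : BrauerConfiguration Γ₀ Γ₁) (V : Γ₁) :
    ∃ a : Γ.Arrow, a.source = Γ.vtx V := by
  obtain ⟨α, hα, h⟩ := Γ.exists_one_lt V
  exact ⟨⟨⟨α, fun h' => h.ne' h'⟩, ⟨V, ⟨0, Multiset.count_pos.2 hα⟩⟩⟩, rfl⟩

theorem exists_total_le (Γ : BrauerConfiguration Γ₀ Γ₁) : ∃ M : ℕ, ∀ a : Γ.Arrow, a.total ≤ M := by
  obtain ⟨M, hM⟩ := (Set.finite_range (Arrow.total : Γ.Arrow → ℕ)).bddAbove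
  exact ⟨M, fun a => hM ⟨a, rfl⟩⟩

/-! ### Words of arrows -/

/-- The list of arrows of a path. -/
def word {u : Γ.QuiverVertex} : ∀ {v : Γ.QuiverVertex}, Quiver.Path u v → List Γ.Arrow
  | _, .nil => []
  | _, .cons p e => word p ++ [e.1]

@[simp] theorem word_nil (u : Γ.QuiverVertex) : word (Quiver.Path.nil : Quiver.Path u u) = [] := rfl

@[simp] theorem word_cons {u v w : Γ.QuiverVertex} (p : Quiver.Path u v) (e : v ⟶ w) :
    word (p.cons e) = word p ++ [e.1] := rfl

@[simp] theorem word_toPath {v w : Γ.QuiverVertex} (e : v ⟶ w) : word e.toPath = [e.1] := rfl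

@[simp] theorem word_comp {u v w : Γ.QuiverVertex} (p : Quiver.Path u v) (q : Quiver.Path v w) :
    word (p.comp q) = word p ++ word q := by
  induction q with
  | nil => simp
  | cons q e ih => rw [Quiver.Path.comp_cons, word_cons, word_cons, ih, List.append_assoc]

theorem word_walk {V : Γ₁} (C : Γ.SpecialCycle V) (n : ℕ) :
    word (C.walk n) = List.iterate Arrow.succ (C.arrow 0) n := by
  induction n with
  | zero => rfl
  | succ n ih =>
    rw [List.iterate_add, SpecialCycle.walk, word_cons, ih, ← C.arrow_eq_iterate n]
    rfl

/-- This is the test for type three relations, used both to see that the trace kills them and to see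
that they kill every product leaving a cycle. -/
theorem eq_succ_of_mem_iterate {l r : List Γ.Arrow} {x y a : Γ.Arrow} {n : ℕ}
    (h : l ++ [x, y] ++ r = List.iterate Arrow.succ a n) : y = x.succ := by
  have hn : l.length + 2 + r.length = n := by
    have := congrArg List.length h
    simp at this
    omega
  have h1 := List.getElem?_iterate Arrow.succ a n l.length (by omega)
  have h2 := List.getElem?_iterate Arrow.succ a n (l.length + 1) (by omega)
  rw [← h] at h1 h2
  simp at h1 h2
  rw [h2, h1, ← Function.iterate_succ_apply, Function.iterate_succ_apply']

/-- All arrows met on a walk have the same `total`, so a walk of at least that length leaves no room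
for padding inside a maximal one. -/
theorem eq_nil_of_iterate_total {l r : List Γ.Arrow} {a b : Γ.Arrow} {n : ℕ} (hn : a.total ≤ n)
    (h : l ++ List.iterate Arrow.succ a n ++ r = List.iterate Arrow.succ b b.total) :
    l = [] ∧ r = [] ∧ n = a.total := by
  have ha : a ∈ List.iterate Arrow.succ b b.total := by
    rw [← h]
    have : a ∈ List.iterate Arrow.succ a n :=
      List.mem_iterate.2 ⟨0, lt_of_lt_of_le a.total_pos hn, rfl⟩
    simp [this]
  obtain ⟨m, -, hm⟩ := List.mem_iterate.1 ha
  have ht : a.total = b.total := by rw [hm, Arrow.total_iterate]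
  have hl : l.length + n + r.length = b.total := by
    simpa [add_assoc] using congrArg List.length h
  refine ⟨List.length_eq_zero_iff.1 (by omega), List.length_eq_zero_iff.1 (by omega), by omega⟩

theorem iterate_succ_inj {a b : Γ.Arrow} {m n : ℕ} (hm : 0 < m)
    (h : List.iterate Arrow.succ a m = List.iterate Arrow.succ b n) : a = b ∧ m = n := by
  have hl : m = n := by simpa using congrArg List.length h
  subst hl
  obtain ⟨k, rfl⟩ : ∃ k, m = k + 1 := ⟨m - 1, by omega⟩
  exact ⟨(List.cons.inj h).1, rfl⟩

/-! ### Walks in the path algebra -/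

section PathAlgebra

open PathAlgebra

variable (K : Type*) [Field K]

theorem ofPath_mul_nil {Q : Type*} [Quiver Q] {a b c : Q} (p : Quiver.Path a b) (h : b = c) :
    ofPath K p * ofPath K (Quiver.Path.nil : Quiver.Path c c) = ofPath K p := by
  subst h
  rw [ofPath_mul_ofPath, Quiver.Path.comp_nil]

theorem nil_mul_ofPath {Q : Type*} [Quiver Q] {a b c : Q} (p : Quiver.Path a b) (h : c = a) :
    ofPath K (Quiver.Path.nil : Quiver.Path c c) * ofPath K p = ofPath K p := by
  subst h
  rw [ofPath_mul_ofPath, Quiver.Path.nil_comp]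

/-- The path with `n` arrows that starts with the arrow `a` and runs around the special cycle
of `a`, in the path algebra. -/
noncomputable def walkPath (a : Γ.Arrow) (n : ℕ) : PathAlgebra K Γ.QuiverVertex :=
  ofPath K (a.cycle.walk n)

/-- An arrow, in the path algebra. -/
noncomputable def arrowPath (a : Γ.Arrow) : PathAlgebra K Γ.QuiverVertex :=
  ofPath K a.toHom.toPath

theorem ofPath_toPath {u v : Γ.QuiverVertex} (e : u ⟶ v) :
    ofPath K e.toPath = arrowPath K e.1 := by
  obtain ⟨a, rfl, rfl⟩ := e
  rfl

theorem ofPath_cons {u v w : Γ.QuiverVertex} (p : Quiver.Path u v) (e : v ⟶ w) :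
    ofPath K (p.cons e) = ofPath K p * arrowPath K e.1 := by
  rw [← ofPath_toPath, ofPath_mul_ofPath]; rfl

theorem walkPath_zero (a : Γ.Arrow) :
    walkPath K a 0 = ofPath K (Quiver.Path.nil : Quiver.Path a.source a.source) := rfl

theorem walkPath_succ (a : Γ.Arrow) (n : ℕ) :
    walkPath K a (n + 1) = walkPath K a n * arrowPath K (Arrow.succ^[n] a) := by
  rw [walkPath, SpecialCycle.walk, ofPath_cons, ← Arrow.cycle_arrow]; rfl

theorem walkPath_add (a : Γ.Arrow) (m n : ℕ) :
    walkPath K a (m + n) = walkPath K a m * walkPath K (Arrow.succ^[m] a) n := by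
  induction n with
  | zero =>
    rw [walkPath_zero, add_zero]
    exact (ofPath_mul_nil K _ (by rw [Arrow.cycle_arrow])).symm
  | succ n ih =>
    rw [← add_assoc, walkPath_succ, ih, walkPath_succ, mul_assoc, ← Function.iterate_add_apply,
      add_comm m n]

theorem walkPath_one (a : Γ.Arrow) : walkPath K a 1 = arrowPath K a := by
  rw [walkPath_succ, walkPath_zero]
  exact nil_mul_ofPath K _ rfl

theorem ofPath_walk {V : Γ₁} (C : Γ.SpecialCycle V) (n : ℕ) :
    ofPath K (C.walk n) = walkPath K (C.arrow 0) n := rfl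

theorem cyclePow_eq {V : Γ₁} (C : Γ.SpecialCycle V) :
    Γ.cyclePow K C = walkPath K (C.arrow 0) (C.arrow 0).total := by
  -- The exponent starts at one: the zeroth power is the unit of the path algebra, whereas the walk
  -- of length zero is a single trivial path.
  have h : ∀ k, ofPath K C.path ^ (k + 1) =
      walkPath K (C.arrow 0) (Γ.val C.vertex * (k + 1)) := by
    intro k
    induction k with
    | zero => rw [zero_add, pow_one, mul_one]; rfl
    | succ k ih =>
      have h2 := (C.arrow 0).succ_iterate_val_mul (k + 1)
      rw [pow_succ, ih, mul_add _ (k + 1), walkPath_add]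
      erw [h2]
      rw [mul_one]; rfl
  obtain ⟨k, hk⟩ : ∃ k, Γ.mult C.vertex = k + 1 := ⟨Γ.mult C.vertex - 1, by
    have := Γ.mult_pos C.vertex; omega⟩
  rw [cyclePow, hk, h, ← hk]; rfl

/-! ### The trace form -/

open Classical in
/-- The linear form on the path algebra that takes the value one at the maximal powers
`C ^ μ(α)` of special cycles, and zero at all other paths. -/
noncomputable def pathTrace : PathAlgebra K Γ.QuiverVertex →ₗ[K] K :=
  Finsupp.linearCombination K fun p =>
    if ∃ a : Γ.Arrow, word p.2.2 = List.iterate Arrow.succ a a.total then (1 : K) else 0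

open Classical in
theorem pathTrace_ofPath {u v : Γ.QuiverVertex} (p : Quiver.Path u v) :
    pathTrace K (ofPath K p) =
      if ∃ a : Γ.Arrow, word p = List.iterate Arrow.succ a a.total then (1 : K) else 0 := by
  unfold pathTrace ofPath
  erw [Finsupp.linearCombination_single, one_smul]

open Classical in
theorem pathTrace_walkPath (a : Γ.Arrow) (n : ℕ) (hn : 0 < n) :
    pathTrace K (walkPath K a n) = if n = a.total then (1 : K) else 0 := by
  rw [walkPath, pathTrace_ofPath, word_walk]
  congr 1
  refine propext ⟨?_, fun h => ⟨a, by rw [← h]; rfl⟩⟩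
  rintro ⟨b, hb⟩
  obtain ⟨rfl, h⟩ := iterate_succ_inj hn hb
  exact h

theorem pathTrace_mul_mul_eq_zero {z : PathAlgebra K Γ.QuiverVertex}
    (h : ∀ {u v u' v' : Γ.QuiverVertex} (p : Quiver.Path u v) (q : Quiver.Path u' v'),
      pathTrace K (ofPath K p * z * ofPath K q) = 0) (x y : PathAlgebra K Γ.QuiverVertex) :
    pathTrace K (x * z * y) = 0 := by
  have h1 : ∀ {u v : Γ.QuiverVertex} (p : Quiver.Path u v) (y : PathAlgebra K Γ.QuiverVertex),
      pathTrace K (ofPath K p * z * y) = 0 := fun p y =>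
    LinearMap.congr_fun (f := (pathTrace K).comp (mulBilin K _ (ofPath K p * z))) (g := 0)
      (hom_ext fun _ _ q => h p q) y
  exact LinearMap.congr_fun
    (f := (pathTrace K).comp (((mulBilin K _).flip y).comp ((mulBilin K _).flip z))) (g := 0)
      (hom_ext fun _ _ p => h1 p y) x

theorem pathTrace_ofPath_of_infix {u v : Γ.QuiverVertex} {p : Quiver.Path u v}
    {l r w : List Γ.Arrow} (hp : word p = l ++ w ++ r)
    (hw : ∀ (l r : List Γ.Arrow) (b : Γ.Arrow),
      l ++ w ++ r ≠ List.iterate Arrow.succ b b.total) : pathTrace K (ofPath K p) = 0 := by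
  rw [pathTrace_ofPath, if_neg]
  rintro ⟨b, hb⟩
  exact hw l r b (hp ▸ hb)

/-- Multiplying by paths only pads the word on both sides. A word that is no factor of a maximal one
therefore generates an ideal of trace zero; relations of types two and three are of this kind. -/
theorem pathTrace_mul_mul_of_infix {s t : Γ.QuiverVertex} {w : Quiver.Path s t}
    (hw : ∀ (l r : List Γ.Arrow) (b : Γ.Arrow),
      l ++ word w ++ r ≠ List.iterate Arrow.succ b b.total)
    (x y : PathAlgebra K Γ.QuiverVertex) :
    pathTrace K (x * ofPath K w * y) = 0 := by
  refine pathTrace_mul_mul_eq_zero K (fun {u v u' v'} p q => ?_) x y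
  by_cases h1 : v = s
  · subst h1
    by_cases h2 : t = u'
    · subst h2
      rw [ofPath_mul_ofPath, ofPath_mul_ofPath]
      exact pathTrace_ofPath_of_infix K (by rw [word_comp, word_comp]) hw
    · rw [ofPath_mul_ofPath, ofPath_mul_ofPath_of_ne _ _ h2, map_zero]
  · rw [ofPath_mul_ofPath_of_ne _ _ h1, zero_mul, map_zero]

-- The value does not involve the arrow `a`, so it is the same for any two maximal walks at one
-- quiver vertex; this is what kills type one relations.
open Classical in
theorem pathTrace_mul_mul_of_word {s t : Γ.QuiverVertex} (W : Quiver.Path s t) (hst : t = s)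
    (a : Γ.Arrow) (hW : word W = List.iterate Arrow.succ a a.total)
    {u v u' v' : Γ.QuiverVertex} (p : Quiver.Path u v) (q : Quiver.Path u' v') :
    pathTrace K (ofPath K p * ofPath K W * ofPath K q) =
      if v = s ∧ u' = s ∧ word p = [] ∧ word q = [] then 1 else 0 := by
  subst hst
  by_cases h1 : v = t
  · subst h1
    by_cases h2 : u' = v
    · subst h2
      rw [ofPath_mul_ofPath, ofPath_mul_ofPath, pathTrace_ofPath, word_comp, word_comp, hW]
      congr 1
      refine propext ⟨?_, ?_⟩
      · rintro ⟨b, hb⟩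
        have := eq_nil_of_iterate_total le_rfl hb
        exact ⟨rfl, rfl, this.1, this.2.1⟩
      · rintro ⟨-, -, h3, h4⟩
        exact ⟨a, by rw [h3, h4]; simp⟩
    · rw [ofPath_mul_ofPath, ofPath_mul_ofPath_of_ne _ _ (Ne.symm h2), map_zero, if_neg]
      exact fun h => h2 h.2.1
  · rw [ofPath_mul_ofPath_of_ne _ _ h1, zero_mul, map_zero, if_neg]
    exact fun h => h1 h.1

open Classical in
theorem pathTrace_relationsOne {z : PathAlgebra K Γ.QuiverVertex} (hz : z ∈ Γ.relationsOne K)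
    (x y : PathAlgebra K Γ.QuiverVertex) : pathTrace K (x * z * y) = 0 := by
  obtain ⟨V, C, C', rfl⟩ := hz
  refine pathTrace_mul_mul_eq_zero K (fun {u v u' v'} p q => ?_) x y
  have key : ∀ C : Γ.SpecialCycle V, pathTrace K (ofPath K p * Γ.cyclePow K C * ofPath K q) =
      if v = Γ.vtx V ∧ u' = Γ.vtx V ∧ word p = [] ∧ word q = [] then 1 else 0 := by
    intro C
    rw [cyclePow_eq, ← ofPath_walk]
    refine pathTrace_mul_mul_of_word K _ ?_ (C.arrow 0) (word_walk _ _) p q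
    rw [C.arrow_eq_iterate, Arrow.succ_iterate_total]
    rfl
  rw [mul_sub, sub_mul, map_sub, key, key, sub_self]

theorem pathTrace_relationsTwo {z : PathAlgebra K Γ.QuiverVertex} (hz : z ∈ Γ.relationsTwo K)
    (x y : PathAlgebra K Γ.QuiverVertex) : pathTrace K (x * z * y) = 0 := by
  obtain ⟨V, C, rfl⟩ := hz
  have h : Γ.cyclePow K C * ofPath K (C.arrow 0).toHom.toPath =
      walkPath K (C.arrow 0) ((C.arrow 0).total + 1) := by
    rw [walkPath_succ, Arrow.succ_iterate_total, cyclePow_eq]; rfl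
  rw [h, ← ofPath_walk]
  refine pathTrace_mul_mul_of_infix K (fun l r b hb => ?_) x y
  rw [word_walk] at hb
  -- The relation is a walk of length `total + 1`, one arrow too long to lie in a maximal walk.
  have := (eq_nil_of_iterate_total (Nat.le_succ _) hb).2.2
  omega

theorem exists_walk_eq (a : Γ.Arrow) {u v w : Γ.QuiverVertex} (e : u ⟶ v) (f : v ⟶ w)
    (he : e.1 = a) (hf : f.1 = a.succ) : IsSubpath (e.toPath.comp f.toPath) (a.cycle.walk 2) := by
  obtain ⟨_, rfl, rfl⟩ := e
  obtain ⟨_, hs, rfl⟩ := f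
  obtain rfl : _ = a := he
  obtain rfl : _ = Arrow.succ _ := hf
  exact ⟨Quiver.Path.nil, Quiver.Path.nil, rfl⟩

theorem IsSubpath.walk_succ {V : Γ₁} (C : Γ.SpecialCycle V) {u v : Γ.QuiverVertex}
    {q : Quiver.Path u v} {n : ℕ} (h : IsSubpath q (C.walk n)) : IsSubpath q (C.walk (n + 1)) := by
  obtain ⟨r, s, hs⟩ := h
  exact ⟨r, s.cons ⟨C.arrow n, rfl, C.arrow_target n⟩, by
    rw [SpecialCycle.walk, hs, Quiver.Path.comp_cons]⟩

theorem IsSubpath.walk_mono {V : Γ₁} (C : Γ.SpecialCycle V) {u v : Γ.QuiverVertex}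
    {q : Quiver.Path u v} {m n : ℕ} (hmn : m ≤ n) (h : IsSubpath q (C.walk m)) :
    IsSubpath q (C.walk n) := by
  induction n, hmn using Nat.le_induction with
  | base => exact h
  | succ n _ ih => exact IsSubpath.walk_succ C ih

theorem pathTrace_relationsThree {z : PathAlgebra K Γ.QuiverVertex} (hz : z ∈ Γ.relationsThree K)
    (x y : PathAlgebra K Γ.QuiverVertex) : pathTrace K (x * z * y) = 0 := by
  obtain ⟨u, v, w, a, b, h1, h2, rfl⟩ := hz
  refine pathTrace_mul_mul_of_infix K (fun l r c hc => ?_) x y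
  have hab : b.1 = a.1.succ := eq_succ_of_mem_iterate (l := l) (r := r) (by
    rw [word_comp, word_toPath, word_toPath] at hc; exact hc)
  have hv : Γ.val a.1.1 ≠ 1 := fun hv =>
    h2 ⟨by rw [hab, Arrow.succ_eq_self_of_val_eq_one _ hv], hv⟩
  have hv' := val_pos (Γ := Γ) a.1.1
  -- Valence one would make `b = a` the exempted loop. So the valence is at least two, and `a b` is
  -- a prefix of the special cycle starting with `a`, against the choice of the relation.
  exact h1 _ a.1.cycle
    (IsSubpath.walk_mono _ (show 2 ≤ Γ.val a.1.1 by omega) (exists_walk_eq a.1 a b rfl hab))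

theorem pathTrace_relationIdeal {z : PathAlgebra K Γ.QuiverVertex} (hz : z ∈ Γ.relationIdeal K) :
    pathTrace K z = 0 := by
  -- The largest two-sided ideal inside the kernel of the trace; containing the generators then
  -- suffices.
  let I : TwoSidedIdeal (PathAlgebra K Γ.QuiverVertex) :=
    TwoSidedIdeal.mk' {z | ∀ x y, pathTrace K (x * z * y) = 0}
      (fun x y => by rw [mul_zero, zero_mul, map_zero])
      (fun {z z'} h h' x y => by rw [mul_add, add_mul, map_add, h, h', add_zero])
      (fun {z} h x y => by rw [mul_neg, neg_mul, map_neg, h, neg_zero])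
      (fun {z z'} h x y => by rw [← mul_assoc, h])
      (fun {z z'} h x y => by rw [← mul_assoc, mul_assoc _ z' y, h])
  have hI : ∀ z, z ∈ I ↔ ∀ x y, pathTrace K (x * z * y) = 0 := fun z =>
    TwoSidedIdeal.mem_mk' ..
  have : Γ.relationIdeal K ≤ I := by
    refine TwoSidedIdeal.span_le.2 ?_
    rintro z ((hz | hz) | hz) <;> refine (hI z).2 ?_
    · exact pathTrace_relationsOne K hz
    · exact pathTrace_relationsTwo K hz
    · exact pathTrace_relationsThree K hz
  simpa using (hI z).1 (this hz) 1 1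

end PathAlgebra

/-! ### The Brauer configuration algebra -/

section Quotient

open PathAlgebra

variable (K : Type*) [Field K]

theorem toBCAlgebra_smul (c : K) (x : PathAlgebra K Γ.QuiverVertex) :
    Γ.toBCAlgebra K (c • x) = c • Γ.toBCAlgebra K x := rfl

theorem toBCAlgebra_surjective : Function.Surjective (Γ.toBCAlgebra K) := fun x =>
  Quotient.inductionOn' x fun y => ⟨y, rfl⟩

theorem toBCAlgebra_eq_zero {x : PathAlgebra K Γ.QuiverVertex} (hx : x ∈ Γ.relationIdeal K) :
    Γ.toBCAlgebra K x = 0 :=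
  (RingCon.eq _).2 hx

/-- The residue class of the path with `n` arrows that starts with the arrow `a` and runs around
the special cycle of `a`. -/
noncomputable def walkElt (a : Γ.Arrow) (n : ℕ) : Γ.BCAlgebra K :=
  Γ.toBCAlgebra K (walkPath K a n)

theorem walkElt_zero (a : Γ.Arrow) : walkElt K a 0 = Γ.idem K a.2.1 := rfl

theorem walkElt_add (a : Γ.Arrow) (m n : ℕ) :
    walkElt K a (m + n) = walkElt K a m * walkElt K (Arrow.succ^[m] a) n := by
  rw [walkElt, walkPath_add, map_mul]; rfl

theorem idem_mul_self (V : Γ₁) : Γ.idem K V * Γ.idem K V = Γ.idem K V := by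
  rw [idem, ← map_mul, ofPath_mul_ofPath]; rfl

theorem idem_mul_idem_of_ne {V W : Γ₁} (h : V ≠ W) : Γ.idem K V * Γ.idem K W = 0 := by
  rw [idem, idem, ← map_mul, ofPath_mul_ofPath_of_ne _ _ (show Γ.vtx V ≠ Γ.vtx W from h),
    map_zero]

theorem idem_mul_walkElt (a : Γ.Arrow) (n : ℕ) :
    Γ.idem K a.2.1 * walkElt K a n = walkElt K a n := by
  have := walkElt_add K a 0 n
  rwa [zero_add, eq_comm] at this

theorem walkElt_mul_idem (a : Γ.Arrow) (n : ℕ) :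
    walkElt K a n * Γ.idem K (Arrow.succ^[n] a).2.1 = walkElt K a n :=
  (walkElt_add K a n 0).symm

theorem idem_mul_walkElt_of_ne {V : Γ₁} {a : Γ.Arrow} (h : V ≠ a.2.1) (n : ℕ) :
    Γ.idem K V * walkElt K a n = 0 := by
  rw [← idem_mul_walkElt, ← mul_assoc, idem_mul_idem_of_ne K h, zero_mul]

theorem walkElt_mul_idem_of_ne {V : Γ₁} {a : Γ.Arrow} {n : ℕ} (h : (Arrow.succ^[n] a).2.1 ≠ V) :
    walkElt K a n * Γ.idem K V = 0 := by
  rw [← walkElt_mul_idem, mul_assoc, idem_mul_idem_of_ne K h, mul_zero]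

/-- Either the arrows do not compose, or their product is a type three relation. The exempted loop
does not interfere, since it is its own successor. -/
theorem arrowPath_mul_arrowPath_of_ne {a b : Γ.Arrow} (h : b ≠ a.succ) :
    Γ.toBCAlgebra K (arrowPath K a * arrowPath K b) = 0 := by
  by_cases hs : a.target = b.source
  · refine toBCAlgebra_eq_zero K (TwoSidedIdeal.subset_span (Or.inr ?_))
    refine ⟨_, _, _, a.toHom, ⟨b, hs.symm, rfl⟩, ?_, ?_, ?_⟩
    · rintro V C ⟨r, s, hrs⟩
      have := congrArg word hrs
      rw [SpecialCycle.path, word_walk, word_comp, word_comp, word_comp, word_toPath,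
        word_toPath] at this
      exact h (eq_succ_of_mem_iterate (l := word r) (r := word s) this.symm)
    · rintro ⟨hab, hv⟩
      have hab : a = b := hab
      have hv : Γ.val a.1.1 = 1 := hv
      exact h (by rw [← hab, Arrow.succ_eq_self_of_val_eq_one _ hv])
    · rw [← ofPath_mul_ofPath, ofPath_toPath, ofPath_toPath]; rfl
  · rw [arrowPath, arrowPath, ofPath_mul_ofPath_of_ne _ _ hs, map_zero]

theorem walkElt_one_mul_of_ne {a b : Γ.Arrow} (h : b ≠ a.succ) :
    walkElt K a 1 * walkElt K b 1 = 0 := by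
  rw [walkElt, walkElt, walkPath_one, walkPath_one, ← map_mul, arrowPath_mul_arrowPath_of_ne K h]

theorem walkElt_mul_of_ne {a b : Γ.Arrow} {m n : ℕ} (hm : 0 < m) (hn : 0 < n)
    (h : b ≠ Arrow.succ^[m] a) : walkElt K a m * walkElt K b n = 0 := by
  obtain ⟨m, rfl⟩ : ∃ k, m = k + 1 := ⟨m - 1, by omega⟩
  obtain ⟨n, rfl⟩ : ∃ k, n = 1 + k := ⟨n - 1, by omega⟩
  rw [Function.iterate_succ_apply'] at h
  rw [walkElt_add, walkElt_add K b, mul_assoc, ← mul_assoc (walkElt K _ 1),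
    walkElt_one_mul_of_ne K h, zero_mul, mul_zero]

theorem walkElt_mul_walkElt_one (a b : Γ.Arrow) (n : ℕ) :
    walkElt K a n * walkElt K b 1 = walkElt K a (n + 1) ∨ walkElt K a n * walkElt K b 1 = 0 ∨
      (n = 0 ∧ walkElt K a n * walkElt K b 1 = walkElt K b 1) := by
  rcases Nat.eq_zero_or_pos n with rfl | hn
  · by_cases h : a.2.1 = b.2.1
    · rw [walkElt_zero, h, idem_mul_walkElt]; simp
    · rw [walkElt_zero, idem_mul_walkElt_of_ne K h]; simp
  · by_cases h : b = Arrow.succ^[n] a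
    · rw [h, ← walkElt_add]; simp
    · rw [walkElt_mul_of_ne K hn one_pos h]; simp

theorem walkElt_total_succ (a : Γ.Arrow) : walkElt K a (a.total + 1) = 0 := by
  refine toBCAlgebra_eq_zero K (TwoSidedIdeal.subset_span (Or.inl (Or.inr ?_)))
  refine ⟨a.2.1, a.cycle, ?_⟩
  rw [cyclePow_eq, walkPath_succ, Arrow.succ_iterate_total]; rfl

theorem walkElt_of_lt {a : Γ.Arrow} {n : ℕ} (h : a.total < n) : walkElt K a n = 0 := by
  obtain ⟨k, rfl⟩ := Nat.exists_eq_add_of_le (Nat.succ_le_of_lt h)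
  rw [walkElt_add, walkElt_total_succ, zero_mul]

theorem walkElt_total_eq {a b : Γ.Arrow} (h : a.2.1 = b.2.1) :
    walkElt K a a.total = walkElt K b b.total := by
  have key : ∀ (V : Γ₁) (C C' : Γ.SpecialCycle V),
      walkElt K (C.arrow 0) (C.arrow 0).total = walkElt K (C'.arrow 0) (C'.arrow 0).total := by
    intro V C C'
    have := toBCAlgebra_eq_zero K (TwoSidedIdeal.subset_span (s := _ ∪ _)
      (Or.inl (Or.inl ⟨V, C, C', rfl⟩)) : Γ.cyclePow K C - Γ.cyclePow K C' ∈ Γ.relationIdeal K)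
    rwa [map_sub, sub_eq_zero, cyclePow_eq, cyclePow_eq] at this
  obtain ⟨α, V, x⟩ := a
  obtain ⟨β, W, y⟩ := b
  obtain rfl : V = W := h
  exact key V ⟨α, x⟩ ⟨β, y⟩

/-- Appending an arrow to a walk of positive length either prolongs it around the same cycle or
gives zero. -/
theorem toBCAlgebra_ofPath {u v : Γ.QuiverVertex} (p : Quiver.Path u v) :
    Γ.toBCAlgebra K (ofPath K p) = 0 ∨ (∃ V, Γ.toBCAlgebra K (ofPath K p) = Γ.idem K V) ∨
      ∃ (a : Γ.Arrow) (n : ℕ), 0 < n ∧ Γ.toBCAlgebra K (ofPath K p) = walkElt K a n := by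
  have harr : ∀ a : Γ.Arrow, Γ.toBCAlgebra K (arrowPath K a) = walkElt K a 1 := fun a => by
    rw [walkElt, walkPath_one]
  induction p with
  | nil => exact Or.inr (Or.inl ⟨u, rfl⟩)
  | cons p e ih =>
    rw [ofPath_cons, map_mul, harr]
    rcases ih with h | ⟨V, h⟩ | ⟨a, n, hn, h⟩
    · rw [h, zero_mul]; exact Or.inl rfl
    · rw [h]
      by_cases hV : V = (e.1).2.1
      · rw [hV, idem_mul_walkElt]
        exact Or.inr (Or.inr ⟨_, 1, one_pos, rfl⟩)
      · rw [idem_mul_walkElt_of_ne K hV]; exact Or.inl rfl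
    · rw [h]
      rcases walkElt_mul_walkElt_one K a e.1 n with h' | h' | h'
      · exact Or.inr (Or.inr ⟨a, n + 1, Nat.succ_pos n, h'⟩)
      · exact Or.inl h'
      · omega

variable {K} in
/-- The Brauer configuration algebra is spanned by its idempotents and by the walks around
special cycles. -/
theorem linear_induction {p : Γ.BCAlgebra K → Prop} (zero : p 0)
    (add : ∀ x y, p x → p y → p (x + y)) (smul : ∀ (c : K) (x), p x → p (c • x))
    (idem : ∀ V, p (Γ.idem K V))
    (walk : ∀ (a : Γ.Arrow) (n : ℕ), 0 < n → n ≤ a.total → p (walkElt K a n))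
    (x : Γ.BCAlgebra K) : p x := by
  obtain ⟨x, rfl⟩ := toBCAlgebra_surjective K x
  induction x using Finsupp.induction_linear with
  | zero => exact (map_zero (Γ.toBCAlgebra K)).symm ▸ zero
  | add f g hf hg => exact (map_add (Γ.toBCAlgebra K) f g).symm ▸ add _ _ hf hg
  | single q c =>
    have h : (Finsupp.single q c : AnyPath Γ.QuiverVertex →₀ K) =
        (c • ofPath K q.2.2 : PathAlgebra K Γ.QuiverVertex) := by
      unfold ofPath
      erw [Finsupp.smul_single, smul_eq_mul, mul_one]
    erw [h, toBCAlgebra_smul]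
    refine smul _ _ ?_
    rcases toBCAlgebra_ofPath K q.2.2 with h | ⟨V, h⟩ | ⟨a, n, hn, h⟩
    · rw [h]; exact zero
    · rw [h]; exact idem V
    · rw [h]
      by_cases hn' : n ≤ a.total
      · exact walk a n hn hn'
      · rw [walkElt_of_lt K (not_le.1 hn')]; exact zero

/-! ### The trace form -/

/-- The trace form of the Brauer configuration algebra. -/
noncomputable def trace : Γ.BCAlgebra K →ₗ[K] K where
  toFun := fun x => Quotient.liftOn' x (pathTrace K) fun x y h => by
    have := pathTrace_relationIdeal K ((TwoSidedIdeal.rel_iff _ _ _).1 h)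
    rwa [map_sub, sub_eq_zero] at this
  map_add' := by
    intro x y
    obtain ⟨x, rfl⟩ := toBCAlgebra_surjective K x
    obtain ⟨y, rfl⟩ := toBCAlgebra_surjective K y
    exact map_add (pathTrace K) x y
  map_smul' := by
    intro c x
    obtain ⟨x, rfl⟩ := toBCAlgebra_surjective K x
    exact map_smul (pathTrace K) c x

theorem trace_walkElt (a : Γ.Arrow) {n : ℕ} (hn : 0 < n) :
    trace K (walkElt K a n) = if n = a.total then 1 else 0 := by
  convert pathTrace_walkPath K a n hn
  rfl

/-- An arrow starting at a given polygon. -/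
noncomputable def baseArrow (Γ : BrauerConfiguration Γ₀ Γ₁) (V : Γ₁) : Γ.Arrow :=
  (Γ.exists_arrow V).choose

theorem baseArrow_fst (V : Γ₁) : (Γ.baseArrow V).2.1 = V := (Γ.exists_arrow V).choose_spec

/-- The common value at a polygon of the maximal powers of special cycles, which spans the socle. -/
noncomputable def top (V : Γ₁) : Γ.BCAlgebra K :=
  walkElt K (Γ.baseArrow V) (Γ.baseArrow V).total

theorem walkElt_total {a : Γ.Arrow} {V : Γ₁} (h : a.2.1 = V) :
    walkElt K a a.total = top K V :=
  walkElt_total_eq K (by rw [h, baseArrow_fst])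

theorem trace_top (V : Γ₁) : trace K (top (Γ := Γ) K V) = 1 := by
  rw [top, trace_walkElt K _ (Arrow.total_pos _), if_pos rfl]

theorem idem_mul_top (V : Γ₁) : Γ.idem K V * top K V = top K V := by
  have := idem_mul_walkElt K (Γ.baseArrow V) (Γ.baseArrow V).total
  rwa [baseArrow_fst] at this

theorem top_mul_idem (V : Γ₁) : top K V * Γ.idem K V = top K V := by
  have := walkElt_mul_idem K (Γ.baseArrow V) (Γ.baseArrow V).total
  rwa [Arrow.succ_iterate_total, baseArrow_fst] at this

/-- The coefficient of the idempotent `e_V`. -/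
noncomputable def coeffIdem (V : Γ₁) : Γ.BCAlgebra K →ₗ[K] K :=
  (trace K).comp (LinearMap.mulRight K (top K V))

/-- The product either leaves the cycle or is a walk longer than `total`; both vanish. -/
theorem walkElt_mul_top (a : Γ.Arrow) {n : ℕ} (hn : 0 < n) (V : Γ₁) :
    walkElt K a n * top K V = 0 := by
  rw [top]
  by_cases h : Γ.baseArrow V = Arrow.succ^[n] a
  · rw [h, ← walkElt_add, Arrow.total_iterate, walkElt_of_lt]
    omega
  · exact walkElt_mul_of_ne K hn (Arrow.total_pos _) h

theorem top_mul_walkElt (a : Γ.Arrow) {n : ℕ} (hn : 0 < n) (V : Γ₁) :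
    top K V * walkElt K a n = 0 := by
  rw [top]
  by_cases h : a = Arrow.succ^[(Γ.baseArrow V).total] (Γ.baseArrow V)
  · rw [h, ← walkElt_add, walkElt_of_lt]
    omega
  · exact walkElt_mul_of_ne K (Arrow.total_pos _) hn h

open Classical in
theorem coeffIdem_idem (V W : Γ₁) :
    coeffIdem K V (Γ.idem K W) = if W = V then 1 else 0 := by
  change trace K (Γ.idem K W * top K V) = _
  split_ifs with h
  · rw [h, idem_mul_top, trace_top]
  · rw [← idem_mul_top, ← mul_assoc, idem_mul_idem_of_ne K h, zero_mul, map_zero]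

theorem coeffIdem_walkElt (V : Γ₁) (a : Γ.Arrow) {n : ℕ} (hn : 0 < n) :
    coeffIdem K V (walkElt K a n) = 0 := by
  change trace K (walkElt K a n * top K V) = _
  rw [walkElt_mul_top K a hn, map_zero]

theorem mul_top (V : Γ₁) (x : Γ.BCAlgebra K) : x * top K V = coeffIdem K V x • top K V := by
  induction x using linear_induction with
  | zero => rw [zero_mul, map_zero, zero_smul]
  | add x y hx hy => rw [add_mul, hx, hy, map_add, add_smul]
  | smul c x hx => rw [smul_mul_assoc, hx, map_smul, smul_assoc]
  | idem W =>
    rw [coeffIdem_idem]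
    split_ifs with h
    · rw [h, idem_mul_top, one_smul]
    · rw [← idem_mul_top, ← mul_assoc, idem_mul_idem_of_ne K h, zero_mul, zero_smul]
  | walk a n hn _ => rw [coeffIdem_walkElt K V a hn, walkElt_mul_top K a hn, zero_smul]

theorem top_mul (V : Γ₁) (x : Γ.BCAlgebra K) : top K V * x = coeffIdem K V x • top K V := by
  induction x using linear_induction with
  | zero => rw [mul_zero, map_zero, zero_smul]
  | add x y hx hy => rw [mul_add, hx, hy, map_add, add_smul]
  | smul c x hx => rw [mul_smul_comm, hx, map_smul, smul_assoc]
  | idem W =>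
    rw [coeffIdem_idem]
    split_ifs with h
    · rw [h, top_mul_idem, one_smul]
    · rw [← top_mul_idem, mul_assoc, idem_mul_idem_of_ne K (Ne.symm h), mul_zero, zero_smul]
  | walk a n hn _ => rw [coeffIdem_walkElt K V a hn, top_mul_walkElt K a hn, zero_smul]

/-- `top` is an eigenvector of every left multiplication and its trace is one, so the eigenvalue is
`coeffIdem` and eigenvalues multiply. -/
theorem coeffIdem_mul (V : Γ₁) (x y : Γ.BCAlgebra K) :
    coeffIdem K V (x * y) = coeffIdem K V x * coeffIdem K V y := by
  change trace K (x * y * top K V) = _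
  rw [mul_assoc, mul_top, mul_smul_comm, mul_top, map_smul, map_smul, trace_top, smul_eq_mul,
    smul_eq_mul, mul_one, mul_comm]

/-! ### Powers of the arrow ideal -/

/-- The span of the walks of length at least `n`. -/
noncomputable def arrowPow (n : ℕ) : Submodule K (Γ.BCAlgebra K) :=
  Submodule.span K {x | ∃ (a : Γ.Arrow) (m : ℕ), n ≤ m ∧ x = walkElt K a m}

theorem walkElt_mem_arrowPow (a : Γ.Arrow) {m n : ℕ} (h : n ≤ m) :
    walkElt K a m ∈ arrowPow (Γ := Γ) K n :=
  Submodule.subset_span ⟨a, m, h, rfl⟩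

theorem sub_sum_mem_arrowPow (x : Γ.BCAlgebra K) :
    x - ∑ V, coeffIdem K V x • Γ.idem K V ∈ arrowPow (Γ := Γ) K 1 := by
  classical
  induction x using linear_induction with
  | zero => simp
  | add x y hx hy =>
    simp only [map_add, add_smul, Finset.sum_add_distrib, add_sub_add_comm]
    exact add_mem hx hy
  | smul c x hx =>
    simp only [map_smul, smul_assoc, ← Finset.smul_sum, ← smul_sub]
    exact Submodule.smul_mem _ c hx
  | idem W => simp [coeffIdem_idem]
  | walk a n hn _ =>
    simp only [coeffIdem_walkElt K _ a hn, zero_smul, Finset.sum_const_zero, sub_zero]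
    exact walkElt_mem_arrowPow K a hn

/-- Walks of positive length have zero coefficients, and subtracting the idempotent part leaves only
such walks. The arrow ideal is thus the common kernel of the characters. -/
theorem mem_arrowPow_one {x : Γ.BCAlgebra K} :
    x ∈ arrowPow (Γ := Γ) K 1 ↔ ∀ V, coeffIdem K V x = 0 := by
  constructor
  · intro h V
    induction h using Submodule.span_induction with
    | mem x h => obtain ⟨a, m, hm, rfl⟩ := h; exact coeffIdem_walkElt K V a hm
    | zero => exact map_zero _
    | add x y _ _ hx hy => rw [map_add, hx, hy, add_zero]
    | smul c x _ hx => rw [map_smul, hx, smul_zero]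
  · intro h
    simpa [h] using sub_sum_mem_arrowPow K x

theorem mul_mem_arrowPow {m n : ℕ} (hm : 0 < m) (hn : 0 < n) {x y : Γ.BCAlgebra K}
    (hx : x ∈ arrowPow (Γ := Γ) K m) (hy : y ∈ arrowPow (Γ := Γ) K n) :
    x * y ∈ arrowPow (Γ := Γ) K (m + n) := by
  induction hx using Submodule.span_induction with
  | zero => rw [zero_mul]; exact zero_mem _
  | add x x' _ _ hx hx' => rw [add_mul]; exact add_mem hx hx'
  | smul c x _ hx => rw [smul_mul_assoc]; exact Submodule.smul_mem _ c hx
  | mem x h =>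
    obtain ⟨a, i, hi, rfl⟩ := h
    induction hy using Submodule.span_induction with
    | zero => rw [mul_zero]; exact zero_mem _
    | add x x' _ _ hx hx' => rw [mul_add]; exact add_mem hx hx'
    | smul c x _ hx => rw [mul_smul_comm]; exact Submodule.smul_mem _ c hx
    | mem y h =>
      obtain ⟨b, j, hj, rfl⟩ := h
      by_cases h : b = Arrow.succ^[i] a
      · rw [h, ← walkElt_add]
        exact walkElt_mem_arrowPow K a (by omega)
      · rw [walkElt_mul_of_ne K (by omega) (by omega) h]
        exact zero_mem _

theorem exists_arrowPow_eq_bot (Γ : BrauerConfiguration Γ₀ Γ₁) :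
    ∃ n, arrowPow (Γ := Γ) K (n + 1) = ⊥ := by
  obtain ⟨M, hM⟩ := Γ.exists_total_le
  refine ⟨M, ?_⟩
  rw [arrowPow, Submodule.span_eq_bot]
  rintro _ ⟨a, m, hm, rfl⟩
  have := hM a
  exact walkElt_of_lt K (by omega)

theorem isNilpotent_of_mem_arrowPow {x : Γ.BCAlgebra K} (hx : x ∈ arrowPow (Γ := Γ) K 1) :
    IsNilpotent x := by
  obtain ⟨n, hn⟩ := exists_arrowPow_eq_bot K Γ
  have h : ∀ k, x ^ (k + 1) ∈ arrowPow (Γ := Γ) K (k + 1) := by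
    intro k
    induction k with
    | zero => simpa using hx
    | succ k ih => rw [pow_succ]; exact mul_mem_arrowPow K k.succ_pos one_pos ih hx
  exact ⟨n + 1, by simpa [hn] using h n⟩

theorem isUnit_smul_one_add {c : K} (hc : c ≠ 0) {x : Γ.BCAlgebra K}
    (hx : x ∈ arrowPow (Γ := Γ) K 1) : IsUnit (c • (1 : Γ.BCAlgebra K) + x) := by
  have h := (isNilpotent_of_mem_arrowPow K (Submodule.smul_mem _ c⁻¹ hx)).isUnit_one_add
  have h2 : c • (1 : Γ.BCAlgebra K) + x =
      algebraMap K (Γ.BCAlgebra K) c * (1 + c⁻¹ • x) := by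
    rw [← Algebra.smul_def, smul_add, smul_inv_smul₀ hc]
  rw [h2]
  exact ((IsUnit.mk0 c hc).map _).mul h

end Quotient

/-! ### The modules `P_V` -/

section Projectives

variable (K : Type*) [Field K]

theorem mem_proj {V : Γ₁} {z : Γ.BCAlgebra K} : z ∈ Γ.proj K V ↔ Γ.idem K V * z = z := by
  rw [proj, Submodule.mem_span_singleton]
  constructor
  · rintro ⟨y, rfl⟩
    rw [← MulOpposite.op_unop y, op_smul_eq_mul, ← mul_assoc, idem_mul_self]
  · intro h
    exact ⟨MulOpposite.op z, h⟩

theorem idem_mul_coe {V : Γ₁} (z : Γ.proj K V) : Γ.idem K V * (z : Γ.BCAlgebra K) = z :=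
  (mem_proj K).1 z.2

theorem mem_span_proj {V : Γ₁} {x y : Γ.proj K V} :
    x ∈ Submodule.span (Γ.BCAlgebra K)ᵐᵒᵖ {y} ↔
      ∃ t : Γ.BCAlgebra K, (x : Γ.BCAlgebra K) = y * t := by
  rw [Submodule.mem_span_singleton]
  constructor
  · rintro ⟨r, rfl⟩
    exact ⟨r.unop, rfl⟩
  · rintro ⟨t, h⟩
    exact ⟨MulOpposite.op t, Subtype.ext h.symm⟩

/-- The generator `e_V` of `P_V`. -/
noncomputable def gen (V : Γ₁) : Γ.proj K V := ⟨Γ.idem K V, Submodule.mem_span_singleton_self _⟩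

theorem mul_mem_proj (V : Γ₁) (y : Γ.BCAlgebra K) : Γ.idem K V * y ∈ Γ.proj K V := by
  rw [mem_proj, ← mul_assoc, idem_mul_self]

theorem coeffIdem_idem_self (V : Γ₁) : coeffIdem K V (Γ.idem K V) = 1 := by
  rw [coeffIdem_idem, if_pos rfl]

theorem gen_ne_zero (V : Γ₁) : gen (Γ := Γ) K V ≠ 0 := by
  intro h
  have h1 : Γ.idem K V = 0 := congrArg Subtype.val h
  have h2 := coeffIdem_idem_self (Γ := Γ) K V
  rw [h1, map_zero] at h2
  exact zero_ne_one h2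

instance (V : Γ₁) : Nontrivial (Γ.proj K V) := ⟨gen K V, 0, gen_ne_zero K V⟩

theorem coeffIdem_of_ne {V W : Γ₁} (h : W ≠ V) {z : Γ.BCAlgebra K} (hz : Γ.idem K V * z = z) :
    coeffIdem K W z = 0 := by
  rw [← hz, coeffIdem_mul, coeffIdem_idem, if_neg (Ne.symm h), zero_mul]

theorem mem_arrowPow_one_of_proj {V : Γ₁} {z : Γ.BCAlgebra K} (hz : Γ.idem K V * z = z)
    (h : coeffIdem K V z = 0) : z ∈ arrowPow (Γ := Γ) K 1 := by
  rw [mem_arrowPow_one]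
  intro W
  by_cases hW : W = V
  · rw [hW, h]
  · exact coeffIdem_of_ne K hW hz

/-- Elements of P_V outside the kernel of the character generate P_V; this makes P_V local. -/
theorem exists_idem_eq_mul {V : Γ₁} {z : Γ.BCAlgebra K} (hz : Γ.idem K V * z = z)
    (h : coeffIdem K V z ≠ 0) : ∃ t, Γ.idem K V = z * t := by
  -- With c the coefficient of z, the unit is u = c + (z e_V - c e_V). The bracket lies in the arrow
  -- ideal, and e_V u = z e_V, so z e_V u⁻¹ = e_V.
  obtain ⟨u, hu⟩ := isUnit_smul_one_add K h
    (x := z * Γ.idem K V - coeffIdem K V z • Γ.idem K V) (by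
      apply mem_arrowPow_one_of_proj K (V := V)
      · rw [mul_sub, ← mul_assoc, hz, mul_smul_comm, idem_mul_self]
      · rw [map_sub, coeffIdem_mul, map_smul, coeffIdem_idem_self, mul_one, smul_eq_mul, mul_one,
          sub_self])
  have h2 : Γ.idem K V * u = z * Γ.idem K V := by
    rw [hu, mul_add, mul_sub, ← mul_assoc, hz, mul_smul_comm, mul_smul_comm, idem_mul_self,
      mul_one, add_sub_cancel]
  refine ⟨Γ.idem K V * (u⁻¹ : (Γ.BCAlgebra K)ˣ), ?_⟩
  rw [← mul_assoc, ← h2, mul_assoc, Units.mul_inv, mul_one]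

/-- The maximal submodule of `P_V`. -/
noncomputable def projRad (V : Γ₁) : Submodule (Γ.BCAlgebra K)ᵐᵒᵖ (Γ.proj K V) where
  carrier := {z | coeffIdem K V (z : Γ.BCAlgebra K) = 0}
  add_mem' := by
    intro x y hx hy
    change coeffIdem K V ((x : Γ.BCAlgebra K) + (y : Γ.BCAlgebra K)) = 0
    rw [map_add, hx, hy, add_zero]
  zero_mem' := map_zero _
  smul_mem' := by
    intro r x hx
    change coeffIdem K V ((x : Γ.BCAlgebra K) * r.unop) = 0
    rw [coeffIdem_mul, hx, zero_mul]

theorem mem_projRad {V : Γ₁} {z : Γ.proj K V} :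
    z ∈ projRad K V ↔ coeffIdem K V (z : Γ.BCAlgebra K) = 0 := Iff.rfl

theorem le_projRad_or_eq_top {V : Γ₁} (A : Submodule (Γ.BCAlgebra K)ᵐᵒᵖ (Γ.proj K V)) :
    A ≤ projRad K V ∨ A = ⊤ := by
  by_contra! h
  obtain ⟨z, hzA, hz⟩ := SetLike.not_le_iff_exists.1 h.1
  obtain ⟨t, ht⟩ := exists_idem_eq_mul K (idem_mul_coe K z) hz
  refine h.2 (eq_top_iff.2 fun x _ => ?_)
  have hx : x ∈ Submodule.span (Γ.BCAlgebra K)ᵐᵒᵖ {z} :=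
    (mem_span_proj K).2 ⟨t * x, by rw [← mul_assoc, ← ht, idem_mul_coe]⟩
  exact (Submodule.span_singleton_le_iff_mem _ _).2 hzA hx

theorem projRad_ne_top (V : Γ₁) : projRad (Γ := Γ) K V ≠ ⊤ := by
  intro h
  have : gen K V ∈ projRad (Γ := Γ) K V := h ▸ Submodule.mem_top
  rw [mem_projRad] at this
  exact one_ne_zero ((coeffIdem_idem_self (Γ := Γ) K V).symm.trans this)

theorem jacobson_proj (V : Γ₁) :
    Module.jacobson (Γ.BCAlgebra K)ᵐᵒᵖ (Γ.proj K V) = projRad K V := by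
  have h : ∀ A : Submodule (Γ.BCAlgebra K)ᵐᵒᵖ (Γ.proj K V), IsCoatom A ↔ A = projRad K V := by
    have hcoatom : IsCoatom (projRad (Γ := Γ) K V) :=
      ⟨projRad_ne_top K V, fun B hB =>
        (le_projRad_or_eq_top K B).resolve_left fun h => absurd hB (not_lt_of_ge h)⟩
    intro A
    refine ⟨fun hA => ?_, fun hA => hA ▸ hcoatom⟩
    have hle := (le_projRad_or_eq_top K A).resolve_right hA.1
    exact (hle.eq_or_lt).resolve_right fun hlt => projRad_ne_top K V (hA.2 _ hlt)
  rw [Module.jacobson]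
  simp only [h, Set.ofPred_eq_eq_singleton, sInf_singleton]

theorem isIndecomposable_proj (V : Γ₁) :
    IsIndecomposableModule (Γ.BCAlgebra K)ᵐᵒᵖ (Γ.proj K V) := by
  refine ⟨inferInstance, fun A B hAB => ?_⟩
  rcases le_projRad_or_eq_top K A with hA | hA
  · rcases le_projRad_or_eq_top K B with hB | hB
    · exact absurd (top_le_iff.1 (hAB.sup_eq_top ▸ sup_le hA hB)) (projRad_ne_top K V)
    · left
      have := hAB.inf_eq_bot
      rwa [hB, inf_top_eq] at this
  · right
    have := hAB.inf_eq_bot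
    rwa [hA, top_inf_eq] at this

theorem projective_proj (V : Γ₁) : Module.Projective (Γ.BCAlgebra K)ᵐᵒᵖ (Γ.proj K V) := by
  let i : Γ.proj K V →ₗ[(Γ.BCAlgebra K)ᵐᵒᵖ] (Γ.BCAlgebra K)ᵐᵒᵖ :=
    { toFun := fun z => MulOpposite.op (z : Γ.BCAlgebra K)
      map_add' := fun _ _ => rfl
      map_smul' := fun _ _ => rfl }
  refine Module.Projective.of_split i (LinearMap.toSpanSingleton _ _ (gen K V)) ?_
  ext z
  exact idem_mul_coe K z

/-- An isomorphism factors e_W through e_V as a product of algebra elements. The character at W is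
one on e_W but zero on e_V when V and W differ. -/
theorem eq_of_proj_equiv {V W : Γ₁}
    (φ : Γ.proj K V ≃ₗ[(Γ.BCAlgebra K)ᵐᵒᵖ] Γ.proj K W) : V = W := by
  by_contra hVW
  have hy : ((φ (gen K V) : Γ.proj K W) : Γ.BCAlgebra K) =
      (φ (gen K V) : Γ.proj K W) * Γ.idem K V := by
    have : gen K V = MulOpposite.op (Γ.idem K V) • gen (Γ := Γ) K V :=
      Subtype.ext (idem_mul_self K V).symm
    conv_lhs => rw [this, map_smul]
    rfl
  have hx : φ.symm (gen K W) =
      MulOpposite.op ((φ.symm (gen K W) : Γ.proj K V) : Γ.BCAlgebra K) • gen K V :=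
    Subtype.ext (idem_mul_coe K _).symm
  have h2 : Γ.idem K W = ((φ (gen K V) : Γ.proj K W) : Γ.BCAlgebra K) *
      ((φ.symm (gen K W) : Γ.proj K V) : Γ.BCAlgebra K) := by
    have h3 := congrArg φ hx
    rw [map_smul, LinearEquiv.apply_symm_apply] at h3
    exact congrArg Subtype.val h3
  have h4 := congrArg (coeffIdem K W) h2
  rw [coeffIdem_idem_self, hy, coeffIdem_mul, coeffIdem_mul, coeffIdem_idem, if_neg hVW, mul_zero,
    zero_mul] at h4
  exact one_ne_zero h4

/-! ### Classification of the indecomposable projectives -/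

/-- If all functionals had values in the arrow ideal, expanding x in a dual basis would push the
values of every functional into all powers of that ideal, hence to zero. The section of the free
cover would then vanish, although it is injective. -/
theorem exists_functional_notMem_arrowPow {P : Type*} [AddCommGroup P]
    [Module (Γ.BCAlgebra K)ᵐᵒᵖ P] [Nontrivial P] (hP : Module.Projective (Γ.BCAlgebra K)ᵐᵒᵖ P) :
    ∃ (f : P →ₗ[(Γ.BCAlgebra K)ᵐᵒᵖ] (Γ.BCAlgebra K)ᵐᵒᵖ) (x : P),
      (f x).unop ∉ arrowPow (Γ := Γ) K 1 := by
  by_contra! h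
  obtain ⟨s, hs⟩ := Module.projective_def.1 hP
  have hpow : ∀ (n : ℕ) (f : P →ₗ[(Γ.BCAlgebra K)ᵐᵒᵖ] (Γ.BCAlgebra K)ᵐᵒᵖ) (x : P),
      (f x).unop ∈ arrowPow (Γ := Γ) K (n + 1) := by
    intro n
    induction n with
    | zero => exact h
    | succ n ih =>
      intro f x
      have hx := hs x
      rw [Finsupp.linearCombination_apply, Finsupp.sum] at hx
      rw [← hx, map_sum, Finset.unop_sum]
      refine Submodule.sum_mem _ fun p _ => ?_
      rw [map_smul]
      -- The coordinates of the section are themselves functionals, so they contribute one more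
      -- factor from the arrow ideal.
      exact mul_mem_arrowPow K n.succ_pos one_pos (ih f p) (h ((Finsupp.lapply p).comp s) x)
  obtain ⟨n, hn⟩ := exists_arrowPow_eq_bot K Γ
  obtain ⟨x, hx⟩ := exists_ne (0 : P)
  refine hx (hs.injective ?_)
  rw [map_zero]
  ext p
  have := hpow n ((Finsupp.lapply p).comp s) x
  rw [hn, Submodule.mem_bot] at this
  exact MulOpposite.unop_injective this

theorem exists_equiv_proj {P : Type*} [AddCommGroup P] [Module (Γ.BCAlgebra K)ᵐᵒᵖ P]
    (hP : Module.Projective (Γ.BCAlgebra K)ᵐᵒᵖ P)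
    (hind : IsIndecomposableModule (Γ.BCAlgebra K)ᵐᵒᵖ P) :
    ∃ V : Γ₁, Nonempty (P ≃ₗ[(Γ.BCAlgebra K)ᵐᵒᵖ] Γ.proj K V) := by
  have := hind.1
  obtain ⟨f, x, hx⟩ := exists_functional_notMem_arrowPow K hP
  rw [mem_arrowPow_one] at hx
  push Not at hx
  obtain ⟨V, hV⟩ := hx
  refine ⟨V, ?_⟩
  -- The functional followed by left multiplication by e_V. Its image is not in the maximal
  -- submodule, so it is onto and splits; indecomposability of P then removes the kernel.
  let g : P →ₗ[(Γ.BCAlgebra K)ᵐᵒᵖ] Γ.proj K V :=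
    (LinearMap.toSpanSingleton _ _ (gen K V)).comp f
  have hgx : coeffIdem K V (g x : Γ.BCAlgebra K) ≠ 0 := by
    change coeffIdem K V (Γ.idem K V * (f x).unop) ≠ 0
    rwa [coeffIdem_mul, coeffIdem_idem_self, one_mul]
  have hg : LinearMap.range g = ⊤ :=
    (le_projRad_or_eq_top K _).resolve_left fun h => hgx (h (LinearMap.mem_range_self g x))
  have hsurj := LinearMap.range_eq_top.1 hg
  have := projective_proj (Γ := Γ) K V
  obtain ⟨h, hgh⟩ := Module.projective_lifting_property g LinearMap.id hsurj
  have hgh' : ∀ y, g (h y) = y := fun y => LinearMap.congr_fun hgh y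
  have hcompl : IsCompl (LinearMap.ker g) (LinearMap.range h) := by
    rw [isCompl_iff, Submodule.disjoint_def, codisjoint_iff, eq_top_iff]
    constructor
    · rintro _ hy ⟨z, rfl⟩
      rw [LinearMap.mem_ker, hgh'] at hy
      rw [hy, map_zero]
    · intro y _
      refine Submodule.mem_sup.2 ⟨y - h (g y), ?_, h (g y), ⟨_, rfl⟩, sub_add_cancel _ _⟩
      rw [LinearMap.mem_ker, map_sub, hgh', sub_self]
  rcases hind.2 _ _ hcompl with hker | hrange
  · exact ⟨LinearEquiv.ofBijective g ⟨LinearMap.ker_eq_bot.1 hker, hsurj⟩⟩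
  · have h0 : h (gen K V) = 0 := by
      rw [← Submodule.mem_bot (R := (Γ.BCAlgebra K)ᵐᵒᵖ), ← hrange]
      exact LinearMap.mem_range_self h _
    have := hgh' (gen K V)
    rw [h0, map_zero] at this
    exact absurd this.symm (gen_ne_zero K V)

end Projectives

end BrauerConfiguration

/-! ### Elementwise criteria for uniseriality -/

theorem isUniserial_of_forall_exists_smul {R M : Type*} [Ring R] [AddCommGroup M] [Module R M]
    (h : ∀ x y : M, (∃ r : R, r • y = x) ∨ ∃ r : R, r • x = y) : IsUniserial R M := by
  intro A B
  by_contra! hAB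
  obtain ⟨x, hxA, hxB⟩ := SetLike.not_le_iff_exists.1 hAB.1
  obtain ⟨y, hyB, hyA⟩ := SetLike.not_le_iff_exists.1 hAB.2
  rcases h x y with ⟨r, rfl⟩ | ⟨r, rfl⟩
  · exact hxB (B.smul_mem r hyB)
  · exact hyA (A.smul_mem r hxA)

theorem mem_heartImage {R M : Type*} [Ring R] [AddCommGroup M] [Module R M]
    {N : Submodule R M} {x : ModuleHeart R M} :
    x ∈ heartImage R N ↔ ∃ z : Module.jacobson R M, (z : M) ∈ N ∧ Submodule.Quotient.mk z = x :=
  Iff.rfl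

theorem isUniserial_heartImage_of_forall {R M : Type*} [Ring R] [AddCommGroup M] [Module R M]
    {N : Submodule R M} (h : ∀ x ∈ N, ∀ y ∈ N, (∃ r : R, r • y = x) ∨ ∃ r : R, r • x = y) :
    IsUniserial R (heartImage R N) := by
  refine isUniserial_of_forall_exists_smul ?_
  rintro ⟨x, hx⟩ ⟨y, hy⟩
  obtain ⟨x, hx', rfl⟩ := mem_heartImage.1 hx
  obtain ⟨y, hy', rfl⟩ := mem_heartImage.1 hy
  rcases h x hx' y hy' with ⟨r, hr⟩ | ⟨r, hr⟩
  · have h : r • y = x := Subtype.ext hr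
    subst h
    exact Or.inl ⟨r, rfl⟩
  · have h : r • x = y := Subtype.ext hr
    subst h
    exact Or.inr ⟨r, rfl⟩

namespace BrauerConfiguration

variable {Γ₀ Γ₁ : Type*} [DecidableEq Γ₀] [Fintype Γ₁] {Γ : BrauerConfiguration Γ₀ Γ₁}

/-! ### The number of special cycles -/

theorem card_specialCycle_add (V : Γ₁) [Fintype Γ₀] [DecidablePred Γ.IsTruncated] :
    Nat.card (Γ.SpecialCycle V) +
      ∑ α ∈ Finset.univ.filter Γ.IsTruncated, (Γ.polygon V).count α = (Γ.polygon V).card := by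
  have : Fintype {α // ¬ Γ.IsTruncated α} := Fintype.ofFinite _
  have h1 : Nat.card (Γ.SpecialCycle V) =
      ∑ α ∈ Finset.univ.filter (fun α => ¬ Γ.IsTruncated α), (Γ.polygon V).count α := by
    rw [Nat.card_sigma]
    refine Eq.trans ?_ (Finset.sum_subtype (F := this) (p := fun α => ¬ Γ.IsTruncated α) _
      (by simp) _).symm
    simp
  rw [h1, add_comm, Finset.sum_filter_add_sum_filter_not]
  exact Multiset.sum_count_eq_card fun _ _ => Finset.mem_univ _

theorem card_specialCycle_of_forall {V : Γ₁} (h : ∀ α ∈ Γ.polygon V, ¬ Γ.IsTruncated α) :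
    Nat.card (Γ.SpecialCycle V) = (Γ.polygon V).card := by
  classical
  have := Γ.finite_vertices
  have := Fintype.ofFinite Γ₀
  rw [← card_specialCycle_add, Finset.sum_eq_zero, add_zero]
  intro α hα
  exact Multiset.count_eq_zero_of_notMem fun h' => h α h' (Finset.mem_filter.1 hα).2

/-- Of the two occurrences at least one is truncated and, by the axiom on polygons, at least one is
not. -/
theorem card_specialCycle_of_exists {V : Γ₁} (hV : (Γ.polygon V).card = 2)
    (h : ∃ α ∈ Γ.polygon V, Γ.IsTruncated α) : Nat.card (Γ.SpecialCycle V) = 1 := by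
  classical
  have := Γ.finite_vertices
  have := Fintype.ofFinite Γ₀
  obtain ⟨α, hα, hαt⟩ := h
  obtain ⟨β, hβ, hβt⟩ := Γ.exists_one_lt V
  have h1 := card_specialCycle_add (Γ := Γ) V
  have h2 : (Γ.polygon V).count α ≤
      ∑ α ∈ Finset.univ.filter Γ.IsTruncated, (Γ.polygon V).count α :=
    Finset.single_le_sum (f := fun α => (Γ.polygon V).count α) (fun _ _ => Nat.zero_le _)
      (Finset.mem_filter.2 ⟨Finset.mem_univ _, hαt⟩)
  have h3 := Multiset.count_pos.2 hα
  have : Nonempty (Γ.SpecialCycle V) :=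
    ⟨⟨⟨β, fun h' => hβt.ne' h'⟩, ⟨0, Multiset.count_pos.2 hβ⟩⟩⟩
  have h4 : 0 < Nat.card (Γ.SpecialCycle V) := Nat.card_pos
  omega

section Modules

variable (K : Type*) [Field K]

/-! ### Multiples of walks -/

variable {K} in
theorem walkElt_mul_induction {p : Γ.BCAlgebra K → Prop} (a : Γ.Arrow) {k : ℕ} (hk : 0 < k)
    (zero : p 0) (add : ∀ x y, p x → p y → p (x + y)) (smul : ∀ (c : K) (x), p x → p (c • x))
    (walk : ∀ j, k ≤ j → j ≤ a.total → p (walkElt K a j)) (t : Γ.BCAlgebra K) :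
    p (walkElt K a k * t) := by
  have walk' : ∀ j, k ≤ j → p (walkElt K a j) := fun j hj => by
    by_cases h : j ≤ a.total
    · exact walk j hj h
    · rw [walkElt_of_lt K (not_le.1 h)]; exact zero
  induction t using linear_induction with
  | zero => rwa [mul_zero]
  | add x y hx hy => rw [mul_add]; exact add _ _ hx hy
  | smul c x hx => rw [mul_smul_comm]; exact smul _ _ hx
  | idem V =>
    by_cases h : (Arrow.succ^[k] a).2.1 = V
    · rw [← h, walkElt_mul_idem]; exact walk' k le_rfl
    · rwa [walkElt_mul_idem_of_ne K h]
  | walk b n hn _ =>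
    by_cases h : b = Arrow.succ^[k] a
    · rw [h, ← walkElt_add]; exact walk' _ (Nat.le_add_right _ _)
    · rwa [walkElt_mul_of_ne K hk hn h]

theorem exists_walkElt_mul_eq_succ (a : Γ.Arrow) {k : ℕ} (hk : 0 < k) {y : Γ.BCAlgebra K}
    (hy : y ∈ arrowPow (Γ := Γ) K 1) : ∃ t, walkElt K a k * y = walkElt K a (k + 1) * t := by
  induction hy using Submodule.span_induction with
  | zero => exact ⟨0, by rw [mul_zero, mul_zero]⟩
  | add x x' _ _ hx hx' =>
    obtain ⟨t, ht⟩ := hx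
    obtain ⟨t', ht'⟩ := hx'
    exact ⟨t + t', by rw [mul_add, mul_add, ht, ht']⟩
  | smul c x _ hx =>
    obtain ⟨t, ht⟩ := hx
    exact ⟨c • t, by rw [mul_smul_comm, mul_smul_comm, ht]⟩
  | mem y h =>
    obtain ⟨b, m, hm, rfl⟩ := h
    by_cases h : b = Arrow.succ^[k] a
    · obtain ⟨m, rfl⟩ := Nat.exists_eq_add_of_le hm
      exact ⟨_, by rw [h, ← walkElt_add, ← add_assoc, walkElt_add K a (k + 1) m]⟩
    · exact ⟨0, by rw [walkElt_mul_of_ne K hk hm h, mul_zero]⟩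

/-- The analogue of writing an element of a valuation ring as a power of the uniformizer times a
unit. Zero is covered by lengths beyond `total`. -/
theorem exists_walkElt_mul_eq_unit (a : Γ.Arrow) {k : ℕ} (hk : 0 < k) (t : Γ.BCAlgebra K) :
    ∃ (l : ℕ) (u : (Γ.BCAlgebra K)ˣ), walkElt K a k * t = walkElt K a l * u := by
  have key : ∀ (d k : ℕ), 0 < k → a.total < k + d → ∀ t : Γ.BCAlgebra K,
      ∃ (l : ℕ) (u : (Γ.BCAlgebra K)ˣ), walkElt K a k * t = walkElt K a l * u := by
    intro d
    induction d with
    | zero =>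
      intro k hk hd t
      exact ⟨k, 1, by rw [walkElt_of_lt K (by omega), zero_mul, zero_mul]⟩
    | succ d ih =>
      intro k hk hd t
      set W := (Arrow.succ^[k] a).2.1 with hW
      have h1 : walkElt K a k * t = walkElt K a k * (Γ.idem K W * t) := by
        rw [← mul_assoc, walkElt_mul_idem]
      -- W is the polygon where the walk ends. If the character at W kills t, the product is a
      -- multiple of the next longer walk; otherwise t may be replaced by a unit.
      by_cases hc : coeffIdem K W t = 0
      · obtain ⟨t', ht'⟩ := exists_walkElt_mul_eq_succ K a hk
          (mem_arrowPow_one_of_proj K (V := W) (z := Γ.idem K W * t)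
            (by rw [← mul_assoc, idem_mul_self])
            (by rw [coeffIdem_mul, hc, mul_zero]))
        rw [h1, ht']
        exact ih (k + 1) k.succ_pos (by omega) t'
      · obtain ⟨u, hu⟩ := isUnit_smul_one_add K hc
          (x := Γ.idem K W * t - coeffIdem K W t • Γ.idem K W) (by
            apply mem_arrowPow_one_of_proj K (V := W)
            · rw [mul_sub, ← mul_assoc, mul_smul_comm, idem_mul_self]
            · rw [map_sub, coeffIdem_mul, map_smul, coeffIdem_idem_self, one_mul, smul_eq_mul,
                mul_one, sub_self])
        refine ⟨k, u, ?_⟩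
        rw [hu, mul_add, mul_sub, ← h1, mul_smul_comm, mul_smul_comm, walkElt_mul_idem, mul_one,
          add_sub_cancel]
  exact key (a.total) k hk (by omega) t

theorem exists_mul_eq_or (a : Γ.Arrow) (s t : Γ.BCAlgebra K) :
    (∃ r, walkElt K a 1 * t * r = walkElt K a 1 * s) ∨
      ∃ r, walkElt K a 1 * s * r = walkElt K a 1 * t := by
  have key : ∀ {k l : ℕ} (_ : k ≤ l) (u v : (Γ.BCAlgebra K)ˣ),
      ∃ r, walkElt K a k * u * r = walkElt K a l * v := by
    intro k l hkl u v
    obtain ⟨m, rfl⟩ := Nat.exists_eq_add_of_le hkl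
    refine ⟨(u⁻¹ : (Γ.BCAlgebra K)ˣ) * (walkElt K (Arrow.succ^[k] a) m * v), ?_⟩
    rw [mul_assoc, Units.mul_inv_cancel_left, walkElt_add, mul_assoc]
  obtain ⟨k, u, hu⟩ := exists_walkElt_mul_eq_unit K a one_pos s
  obtain ⟨l, v, hv⟩ := exists_walkElt_mul_eq_unit K a one_pos t
  rw [hu, hv]
  rcases le_total k l with h | h
  · exact Or.inr (key h u v)
  · exact Or.inl (key h v u)

/-! ### Dual walks -/

/-- The complement in `C ^ μ(α)` of the prefix of length `j`. -/
noncomputable def dualElt (a : Γ.Arrow) (j : ℕ) : Γ.BCAlgebra K :=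
  walkElt K (Arrow.succ^[j] a) (a.total - j)

theorem dualElt_mem_arrowPow (a : Γ.Arrow) {j : ℕ} (hj : j < a.total) :
    dualElt K a j ∈ arrowPow (Γ := Γ) K 1 :=
  walkElt_mem_arrowPow K _ (by omega)

-- A nonzero product must continue the walk of `a` up to exactly `total` steps, and injectivity of
-- the successor then recovers `a = b`. The case `j = b.total` is excluded because different cycles
-- at a polygon share their maximal walk.
open Classical in
theorem trace_walkElt_mul_dualElt (a b : Γ.Arrow) {i j : ℕ} (hi : 0 < i) (hj : j < b.total) :
    trace K (walkElt K a i * dualElt K b j) = if a = b ∧ i = j then 1 else 0 := by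
  rw [dualElt]
  by_cases h : Arrow.succ^[j] b = Arrow.succ^[i] a
  · have ht : a.total = b.total := by
      rw [← Arrow.total_iterate a i, ← h, Arrow.total_iterate]
    rw [h, ← walkElt_add, trace_walkElt K a (by omega)]
    congr 1
    refine propext ⟨fun h' => ?_, fun h' => by omega⟩
    have hij : i = j := by omega
    subst hij
    exact ⟨(Arrow.succ_injective.iterate i h).symm, rfl⟩
  · rw [walkElt_mul_of_ne K hi (by omega) h, map_zero, if_neg]
    rintro ⟨rfl, rfl⟩
    exact h rfl

theorem trace_walkElt_mul_dualElt_self (a : Γ.Arrow) {i j : ℕ} (hi : 0 < i) (hj : j ≤ a.total) :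
    trace K (walkElt K a i * dualElt K a j) = if i = j then 1 else 0 := by
  rcases hj.lt_or_eq with hj | rfl
  · rw [trace_walkElt_mul_dualElt K a a hi hj]
    simp
  -- For `j = a.total` the dual walk is the idempotent at the start of `a`.
  · rw [dualElt, Nat.sub_self, Arrow.succ_iterate_total, walkElt_zero]
    by_cases h : (Arrow.succ^[i] a).2.1 = a.2.1
    · rw [← h, walkElt_mul_idem, trace_walkElt K a hi]
    · rw [walkElt_mul_idem_of_ne K h, map_zero, if_neg]
      rintro rfl
      exact h (by rw [Arrow.succ_iterate_total])

theorem top_mul_dualElt (V : Γ₁) (a : Γ.Arrow) {j : ℕ} (hj : j < a.total) :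
    top K V * dualElt K a j = 0 :=
  top_mul_walkElt K _ (by omega) V

/-! ### The modules `U_1(C)` -/

variable {V : Γ₁}

theorem mem_uniserialSubmodule {C : Γ.SpecialCycle V} {x : Γ.proj K V} :
    x ∈ Γ.uniserialSubmodule K C 1 ↔
      ∃ t : Γ.BCAlgebra K, (x : Γ.BCAlgebra K) = walkElt K (C.arrow 0) 1 * t :=
  mem_span_proj K

theorem prefixElt_mem (C : Γ.SpecialCycle V) {j : ℕ} (hj : 0 < j) :
    Γ.prefixElt K C j ∈ Γ.uniserialSubmodule K C 1 := by
  obtain ⟨j, rfl⟩ : ∃ k, j = 1 + k := ⟨j - 1, by omega⟩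
  exact (mem_uniserialSubmodule K).2 ⟨_, walkElt_add K (C.arrow 0) 1 j⟩

theorem exists_smul_eq_of_mem_uniserial {C : Γ.SpecialCycle V} {x y : Γ.proj K V}
    (hx : x ∈ Γ.uniserialSubmodule K C 1) (hy : y ∈ Γ.uniserialSubmodule K C 1) :
    (∃ r : (Γ.BCAlgebra K)ᵐᵒᵖ, r • y = x) ∨ ∃ r : (Γ.BCAlgebra K)ᵐᵒᵖ, r • x = y := by
  obtain ⟨s, hs⟩ := (mem_uniserialSubmodule K).1 hx
  obtain ⟨t, ht⟩ := (mem_uniserialSubmodule K).1 hy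
  have h := exists_mul_eq_or K (C.arrow 0) s t
  rw [← hs, ← ht] at h
  rcases h with ⟨r, hr⟩ | ⟨r, hr⟩
  · exact Or.inl ⟨MulOpposite.op r, Subtype.ext hr⟩
  · exact Or.inr ⟨MulOpposite.op r, Subtype.ext hr⟩

theorem isUniserial_uniserialSubmodule (C : Γ.SpecialCycle V) :
    IsUniserial (Γ.BCAlgebra K)ᵐᵒᵖ (Γ.uniserialSubmodule K C 1) := by
  refine isUniserial_of_forall_exists_smul fun x y => ?_
  rcases exists_smul_eq_of_mem_uniserial K x.2 y.2 with ⟨r, hr⟩ | ⟨r, hr⟩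
  · exact Or.inl ⟨r, Subtype.ext hr⟩
  · exact Or.inr ⟨r, Subtype.ext hr⟩

theorem linearIndependent_prefixElt (C : Γ.SpecialCycle V) :
    LinearIndependent K (fun j : Fin (Γ.val C.vertex * Γ.mult C.vertex) =>
      Γ.prefixElt K C (j + 1)) := by
  let ι : Γ.proj K V →ₗ[K] Γ.BCAlgebra K :=
    { toFun := Subtype.val
      map_add' := fun _ _ => rfl
      map_smul' := fun _ _ => rfl }
  have key : ∀ i j : Fin (Γ.val C.vertex * Γ.mult C.vertex),
      trace K (walkElt K (C.arrow 0) (j + 1) * dualElt K (C.arrow 0) (i + 1)) =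
        if (j : ℕ) + 1 = i + 1 then 1 else 0 := fun i j =>
    trace_walkElt_mul_dualElt_self K _ (Nat.succ_pos _) i.2
  refine LinearIndependent.of_pairwise_dual_eq_zero_one _
    (fun i => ((trace K).comp (LinearMap.mulRight K (dualElt K (C.arrow 0) (i + 1)))).comp ι)
    (fun i j hij => ?_) (fun i => ?_)
  · refine (key i j).trans (if_neg fun h => hij (Fin.ext ?_))
    omega
  · exact (key i i).trans (if_pos rfl)

theorem span_prefixElt (C : Γ.SpecialCycle V) :
    (Submodule.span K (Set.range fun j : Fin (Γ.val C.vertex * Γ.mult C.vertex) =>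
      Γ.prefixElt K C (j + 1)) : Set (Γ.proj K V)) = Γ.uniserialSubmodule K C 1 := by
  ext x
  constructor
  · intro hx
    induction hx using Submodule.span_induction with
    | mem x hx => obtain ⟨j, rfl⟩ := hx; exact prefixElt_mem K C (Nat.succ_pos _)
    | zero => exact zero_mem (Γ.uniserialSubmodule K C 1)
    | add x y _ _ hx hy => exact add_mem (S := Submodule _ _) hx hy
    | smul c x _ hx => exact Submodule.smul_of_tower_mem (Γ.uniserialSubmodule K C 1) c hx
  · intro hx
    obtain ⟨t, ht⟩ := (mem_uniserialSubmodule K).1 hx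
    have key : ∃ y ∈ Submodule.span K (Set.range
        fun j : Fin (Γ.val C.vertex * Γ.mult C.vertex) => Γ.prefixElt K C (j + 1)),
        (y : Γ.BCAlgebra K) = walkElt K (C.arrow 0) 1 * t := by
      refine walkElt_mul_induction (p := fun z => ∃ y ∈ Submodule.span K (Set.range
        fun j : Fin (Γ.val C.vertex * Γ.mult C.vertex) => Γ.prefixElt K C (j + 1)),
        (y : Γ.BCAlgebra K) = z) (C.arrow 0) one_pos ⟨0, zero_mem _, rfl⟩ ?_ ?_ ?_ t
      · rintro _ _ ⟨x, hx, rfl⟩ ⟨y, hy, rfl⟩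
        exact ⟨x + y, add_mem hx hy, rfl⟩
      · rintro c _ ⟨x, hx, rfl⟩
        exact ⟨c • x, Submodule.smul_mem _ c hx, rfl⟩
      · intro j hj hj'
        obtain ⟨j, rfl⟩ : ∃ k, j = k + 1 := ⟨j - 1, by omega⟩
        exact ⟨_, Submodule.subset_span ⟨⟨j, hj'⟩, rfl⟩, rfl⟩
    obtain ⟨y, hy, hyx⟩ := key
    rwa [Subtype.ext (hyx.trans ht.symm)] at hy

theorem eq_trace_smul_top_of_mem_uniserial {C : Γ.SpecialCycle V} {x : Γ.proj K V}
    (hx : x ∈ Γ.uniserialSubmodule K C 1)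
    (h : ∀ j, 0 < j → j < (C.arrow 0).total →
      trace K ((x : Γ.BCAlgebra K) * dualElt K (C.arrow 0) j) = 0) :
    ∃ c : K, (x : Γ.BCAlgebra K) = c • top K V := by
  classical
  obtain ⟨t, ht⟩ := (mem_uniserialSubmodule K).1 hx
  -- Dual-basis expansion of an element of U_1(C). If all coefficients below `total` vanish, only
  -- the term in `top` remains.
  have key : walkElt K (C.arrow 0) 1 * t = ∑ j ∈ Finset.Icc 1 (C.arrow 0).total,
      trace K (walkElt K (C.arrow 0) 1 * t * dualElt K (C.arrow 0) j) •
        walkElt K (C.arrow 0) j := by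
    refine walkElt_mul_induction (p := fun z => z = ∑ j ∈ Finset.Icc 1 (C.arrow 0).total,
      trace K (z * dualElt K (C.arrow 0) j) • walkElt K (C.arrow 0) j) (C.arrow 0) one_pos
      ?_ ?_ ?_ ?_ t
    · simp
    · intro x y hx hy
      simp only [add_mul, map_add, add_smul, Finset.sum_add_distrib]
      rw [← hx, ← hy]
    · intro c x hx
      simp only [smul_mul_assoc, map_smul, smul_assoc, ← Finset.smul_sum]
      rw [← hx]
    · intro i hi hi'
      rw [Finset.sum_eq_single i]
      · rw [trace_walkElt_mul_dualElt_self K _ hi hi', if_pos rfl, one_smul]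
      · intro j hj hji
        rw [trace_walkElt_mul_dualElt_self K _ hi (Finset.mem_Icc.1 hj).2, if_neg (Ne.symm hji),
          zero_smul]
      · intro h
        exact absurd (Finset.mem_Icc.2 ⟨hi, hi'⟩) h
  refine ⟨trace K ((x : Γ.BCAlgebra K) * dualElt K (C.arrow 0) (C.arrow 0).total), ?_⟩
  rw [← ht] at key
  conv_lhs => rw [key]
  rw [Finset.sum_eq_single (C.arrow 0).total, walkElt_total K (V := V) rfl]
  · intro j hj hjt
    have := Finset.mem_Icc.1 hj
    rw [h j (by omega) (by omega), zero_smul]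
  · intro h
    exact absurd (Finset.mem_Icc.2 ⟨Arrow.total_pos _, le_rfl⟩) h

theorem arrow_zero_injective : Function.Injective fun C : Γ.SpecialCycle V => C.arrow 0 := by
  rintro ⟨α, x⟩ ⟨β, y⟩ h
  have h1 : α = β := congrArg Sigma.fst h
  subst h1
  have h2 : (⟨V, x⟩ : Γ.Occ α.1) = ⟨V, y⟩ := eq_of_heq (Sigma.mk.inj h).2
  rw [eq_of_heq (Sigma.mk.inj h2).2]

theorem trace_mul_dualElt_of_ne {C C' : Γ.SpecialCycle V} (hC : C ≠ C') {x : Γ.proj K V}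
    (hx : x ∈ Γ.uniserialSubmodule K C 1) {j : ℕ} (hj : j < (C'.arrow 0).total) :
    trace K ((x : Γ.BCAlgebra K) * dualElt K (C'.arrow 0) j) = 0 := by
  obtain ⟨t, ht⟩ := (mem_uniserialSubmodule K).1 hx
  rw [ht]
  refine walkElt_mul_induction (p := fun z => trace K (z * dualElt K (C'.arrow 0) j) = 0)
    (C.arrow 0) one_pos (by simp) (fun x y hx hy => by rw [add_mul, map_add, hx, hy, add_zero])
    (fun c x hx => by rw [smul_mul_assoc, map_smul, hx, smul_zero]) (fun i hi _ => ?_) t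
  rw [trace_walkElt_mul_dualElt K _ _ hi hj, if_neg]
  exact fun h => hC (arrow_zero_injective h.1)

theorem uniserialSubmodule_le_projRad (C : Γ.SpecialCycle V) :
    Γ.uniserialSubmodule K C 1 ≤ projRad K V := by
  intro x hx
  obtain ⟨t, ht⟩ := (mem_uniserialSubmodule K).1 hx
  rw [mem_projRad, ht, coeffIdem_mul, coeffIdem_walkElt K V _ one_pos, zero_mul]

theorem projRad_eq_iSup : projRad K V = ⨆ C : Γ.SpecialCycle V, Γ.uniserialSubmodule K C 1 := by
  refine le_antisymm (fun x hx => ?_) (iSup_le fun C => uniserialSubmodule_le_projRad K C)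
  have key : ∀ y ∈ arrowPow (Γ := Γ) K 1, (⟨Γ.idem K V * y, mul_mem_proj K V y⟩ : Γ.proj K V) ∈
      ⨆ C : Γ.SpecialCycle V, Γ.uniserialSubmodule K C 1 := by
    intro y hy
    induction hy using Submodule.span_induction with
    | zero => simp only [mul_zero]; exact zero_mem _
    | add x y _ _ hx hy => simp only [mul_add]; exact add_mem hx hy
    | smul c x _ hx =>
      simp only [mul_smul_comm]
      exact Submodule.smul_of_tower_mem _ c hx
    | mem y h =>
      obtain ⟨⟨α, W, i⟩, m, hm, rfl⟩ := h
      by_cases h : V = W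
      · subst h
        refine Submodule.mem_iSup_of_mem (⟨α, i⟩ : Γ.SpecialCycle V) ?_
        have := prefixElt_mem K (⟨α, i⟩ : Γ.SpecialCycle V) hm
        convert this using 1
        exact Subtype.ext (idem_mul_walkElt K (⟨α, V, i⟩ : Γ.Arrow) m)
      · have := idem_mul_walkElt_of_ne K (a := (⟨α, W, i⟩ : Γ.Arrow)) h m
        simp only [this]
        exact zero_mem _
  have h := key x (mem_arrowPow_one_of_proj K (idem_mul_coe K x) hx)
  simpa only [idem_mul_coe, Subtype.coe_eta] using h

/-! ### The socle -/

/-- The generator of the socle of `P_V`. -/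
noncomputable def topElt (V : Γ₁) : Γ.proj K V := ⟨top K V, (mem_proj K).2 (idem_mul_top K V)⟩

theorem topElt_ne_zero (V : Γ₁) : topElt (Γ := Γ) K V ≠ 0 := by
  intro h
  have h1 : top (Γ := Γ) K V = 0 := congrArg Subtype.val h
  have h2 := trace_top (Γ := Γ) K V
  rw [h1, map_zero] at h2
  exact zero_ne_one h2

theorem top_mem_arrowPow (V : Γ₁) : top K V ∈ arrowPow (Γ := Γ) K 1 :=
  walkElt_mem_arrowPow K _ (Arrow.total_pos _)

/-- In the expansion of z along the walks at V, every coefficient other than that of `top` is a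
trace of z times an element of the arrow ideal. -/
theorem eq_trace_smul_top_of_annihilator {z : Γ.BCAlgebra K} (hz : Γ.idem K V * z = z)
    (h : ∀ y ∈ arrowPow (Γ := Γ) K 1, z * y = 0) : z = trace K z • top K V := by
  classical
  have hc : coeffIdem K V z = 0 := by
    change trace K (z * top K V) = 0
    rw [h _ (top_mem_arrowPow K V), map_zero]
  have := Fintype.ofFinite (Γ.SpecialCycle V)
  -- The inner sums stop before `total`: the maximal walks of all cycles at V are one element, which
  -- is counted once by the last term.
  have key : ∀ y ∈ arrowPow (Γ := Γ) K 1, Γ.idem K V * y =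
      (∑ C : Γ.SpecialCycle V, ∑ j ∈ Finset.Ico 1 (C.arrow 0).total,
        trace K (Γ.idem K V * y * dualElt K (C.arrow 0) j) • walkElt K (C.arrow 0) j) +
      trace K (Γ.idem K V * y) • top K V := by
    intro y hy
    induction hy using Submodule.span_induction with
    | zero => simp
    | add x y _ _ hx hy =>
      simp only [mul_add, add_mul, map_add, add_smul, Finset.sum_add_distrib]
      rw [add_add_add_comm, ← hx, ← hy]
    | smul c x _ hx =>
      simp only [mul_smul_comm, smul_mul_assoc, map_smul, smul_assoc, ← Finset.smul_sum]
      rw [← smul_add, ← hx]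
    | mem y h =>
      obtain ⟨⟨α, W, x⟩, i, hi, rfl⟩ := h
      by_cases h : V = W
      · subst h
        have hC : (⟨α, V, x⟩ : Γ.Arrow) = SpecialCycle.arrow (⟨α, x⟩ : Γ.SpecialCycle V) 0 := rfl
        have hid : Γ.idem K V * walkElt K (⟨α, V, x⟩ : Γ.Arrow) i =
          walkElt K (⟨α, V, x⟩ : Γ.Arrow) i := idem_mul_walkElt K (⟨α, V, x⟩ : Γ.Arrow) i
        rw [hid, hC]
        generalize (⟨α, x⟩ : Γ.SpecialCycle V) = C
        have hother : ∀ (C' : Γ.SpecialCycle V) (j : ℕ), j < (C'.arrow 0).total →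
            ¬ (C' = C ∧ j = i) →
            trace K (walkElt K (SpecialCycle.arrow C 0) i * dualElt K (C'.arrow 0) j) •
              walkElt K (C'.arrow 0) j = 0 := fun C' j hj hne => by
          rw [trace_walkElt_mul_dualElt K _ _ hi hj, if_neg, zero_smul]
          exact fun h' => hne ⟨(arrow_zero_injective h'.1).symm, h'.2.symm⟩
        rw [trace_walkElt K _ hi]
        rcases lt_trichotomy i (SpecialCycle.arrow C 0).total with hlt | heq | hgt
        · rw [if_neg hlt.ne, zero_smul, add_zero, Finset.sum_eq_single C, Finset.sum_eq_single i,
            trace_walkElt_mul_dualElt K _ _ hi hlt, if_pos ⟨rfl, rfl⟩, one_smul]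
          · intro j hj hji
            exact hother C j (Finset.mem_Ico.1 hj).2 fun h' => hji h'.2
          · intro h'
            exact absurd (Finset.mem_Ico.2 ⟨hi, hlt⟩) h'
          · intro C' _ hC'
            exact Finset.sum_eq_zero fun j hj =>
              hother C' j (Finset.mem_Ico.1 hj).2 fun h' => hC' h'.1
          · intro h'
            exact absurd (Finset.mem_univ _) h'
        · rw [if_pos heq, one_smul, Finset.sum_eq_zero, zero_add, heq, walkElt_total K (V := V) rfl]
          intro C' _
          refine Finset.sum_eq_zero fun j hj => hother C' j (Finset.mem_Ico.1 hj).2 fun h' => ?_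
          have := (Finset.mem_Ico.1 hj).2
          rw [h'.1, h'.2] at this
          omega
        · rw [walkElt_of_lt K hgt, if_neg hgt.ne']
          simp
      · have := idem_mul_walkElt_of_ne K (a := (⟨α, W, x⟩ : Γ.Arrow)) h i
        rw [this]
        simp
  have h2 := key z (mem_arrowPow_one_of_proj K hz hc)
  rw [hz, Finset.sum_eq_zero, zero_add] at h2
  · exact h2
  · intro C _
    refine Finset.sum_eq_zero fun j hj => ?_
    rw [h _ (dualElt_mem_arrowPow K _ (Finset.mem_Ico.1 hj).2), map_zero, zero_smul]

/-- Otherwise each nonzero multiple of z could be multiplied by a further element of the arrow ideal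
without vanishing, against nilpotency. -/
theorem exists_mul_annihilator {z : Γ.BCAlgebra K} (hz : z ≠ 0) :
    ∃ t, z * t ≠ 0 ∧ ∀ y ∈ arrowPow (Γ := Γ) K 1, z * t * y = 0 := by
  by_contra! h
  have key : ∀ n, ∃ t ∈ arrowPow (Γ := Γ) K (n + 1), z * t ≠ 0 := by
    intro n
    induction n with
    | zero =>
      obtain ⟨y, hy, hzy⟩ := h 1 (by rwa [mul_one])
      exact ⟨y, hy, by rwa [mul_one] at hzy⟩
    | succ n ih =>
      obtain ⟨t, ht, hzt⟩ := ih
      obtain ⟨y, hy, hzy⟩ := h t hzt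
      exact ⟨t * y, mul_mem_arrowPow K n.succ_pos one_pos ht hy, by rwa [← mul_assoc]⟩
  obtain ⟨n, hn⟩ := exists_arrowPow_eq_bot K Γ
  obtain ⟨t, ht, hzt⟩ := key n
  rw [hn, Submodule.mem_bot] at ht
  exact hzt (by rw [ht, mul_zero])

/-- This one statement makes the submodule spanned by `top` the unique simple one and places it
inside every U_1(C). -/
theorem topElt_mem {N : Submodule (Γ.BCAlgebra K)ᵐᵒᵖ (Γ.proj K V)} (hN : N ≠ ⊥) :
    topElt K V ∈ N := by
  obtain ⟨z, hzN, hz⟩ := N.ne_bot_iff.1 hN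
  obtain ⟨t, ht, hty⟩ := exists_mul_annihilator K (z := (z : Γ.BCAlgebra K))
    fun h => hz (Subtype.ext h)
  have h1 := eq_trace_smul_top_of_annihilator K (V := V) (z := (z : Γ.BCAlgebra K) * t)
    (by rw [← mul_assoc, idem_mul_coe]) hty
  have hc : trace K ((z : Γ.BCAlgebra K) * t) ≠ 0 := fun h0 => ht (by rw [h1, h0, zero_smul])
  have h2 : topElt K V = (trace K ((z : Γ.BCAlgebra K) * t))⁻¹ • (MulOpposite.op t • z) := by
    refine Subtype.ext ?_
    change top K V = (trace K ((z : Γ.BCAlgebra K) * t))⁻¹ • ((z : Γ.BCAlgebra K) * t)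
    nth_rewrite 2 [h1]
    rw [inv_smul_smul₀ hc]
  rw [h2]
  exact Submodule.smul_of_tower_mem _ _ (N.smul_mem _ hzN)

theorem isAtom_span_topElt :
    IsAtom (Submodule.span (Γ.BCAlgebra K)ᵐᵒᵖ {topElt (Γ := Γ) K V}) := by
  refine ⟨fun h => topElt_ne_zero K V (Submodule.span_singleton_eq_bot.1 h), fun B hB => ?_⟩
  by_contra hne
  exact absurd hB (not_lt_of_ge ((Submodule.span_singleton_le_iff_mem _ _).2 (topElt_mem K hne)))

theorem moduleSocle_proj : moduleSocle (Γ.BCAlgebra K)ᵐᵒᵖ (Γ.proj K V) =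
    Submodule.span (Γ.BCAlgebra K)ᵐᵒᵖ {topElt K V} := by
  refine le_antisymm (sSup_le fun T hT => ?_) (le_sSup ?_)
  · have hT' : IsAtom T := isSimpleModule_iff_isAtom.1 hT
    have hle := (Submodule.span_singleton_le_iff_mem _ _).2 (topElt_mem K hT'.1)
    exact ((hT'.le_iff.1 hle).resolve_left (isAtom_span_topElt K).1).ge
  · exact isSimpleModule_iff_isAtom.2 (isAtom_span_topElt K)

theorem mem_moduleSocle {x : Γ.proj K V} : x ∈ moduleSocle (Γ.BCAlgebra K)ᵐᵒᵖ (Γ.proj K V) ↔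
    ∃ c : K, (x : Γ.BCAlgebra K) = c • top K V := by
  rw [moduleSocle_proj, mem_span_proj]
  constructor
  · rintro ⟨t, ht⟩
    exact ⟨coeffIdem K V t, ht.trans (top_mul K V t)⟩
  · rintro ⟨c, hc⟩
    exact ⟨c • 1, by rw [hc, mul_smul_comm, mul_one]; rfl⟩

theorem isSimpleModule_moduleSocle :
    IsSimpleModule (Γ.BCAlgebra K)ᵐᵒᵖ (moduleSocle (Γ.BCAlgebra K)ᵐᵒᵖ (Γ.proj K V)) := by
  rw [moduleSocle_proj]
  exact isSimpleModule_iff_isAtom.2 (isAtom_span_topElt K)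

theorem moduleSocle_le {N : Submodule (Γ.BCAlgebra K)ᵐᵒᵖ (Γ.proj K V)} (hN : N ≠ ⊥) :
    moduleSocle (Γ.BCAlgebra K)ᵐᵒᵖ (Γ.proj K V) ≤ N := by
  rw [moduleSocle_proj]
  exact (Submodule.span_singleton_le_iff_mem _ _).2 (topElt_mem K hN)

/-- Since the vertex is nontruncated, `total` is at least two. The dual walk of the first arrow thus
has positive length and kills `top`, yet it pairs to one with that arrow. -/
theorem prefixElt_one_notMem_moduleSocle (C : Γ.SpecialCycle V) :
    Γ.prefixElt K C 1 ∉ moduleSocle (Γ.BCAlgebra K)ᵐᵒᵖ (Γ.proj K V) := by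
  intro h
  obtain ⟨c, hc⟩ := (mem_moduleSocle K).1 h
  have hlt : 1 < (C.arrow 0).total := (C.arrow 0).two_le_total
  have h1 := trace_walkElt_mul_dualElt_self K (C.arrow 0) one_pos hlt.le
  have hc' : walkElt K (C.arrow 0) 1 = c • top K V := hc
  rw [hc', smul_mul_assoc, top_mul_dualElt K V _ hlt, smul_zero, map_zero, if_pos rfl] at h1
  exact zero_ne_one h1

theorem uniserialSubmodule_ne_bot (C : Γ.SpecialCycle V) : Γ.uniserialSubmodule K C 1 ≠ ⊥ := by
  intro h
  have h1 := prefixElt_mem K C one_pos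
  rw [h, Submodule.mem_bot] at h1
  exact prefixElt_one_notMem_moduleSocle K C (h1 ▸ zero_mem _)

theorem uniserialSubmodule_inf {C C' : Γ.SpecialCycle V} (hC : C ≠ C') :
    Γ.uniserialSubmodule K C 1 ⊓ Γ.uniserialSubmodule K C' 1 =
      moduleSocle (Γ.BCAlgebra K)ᵐᵒᵖ (Γ.proj K V) := by
  refine le_antisymm (fun x hx => ?_) (le_inf (moduleSocle_le K (uniserialSubmodule_ne_bot K C))
    (moduleSocle_le K (uniserialSubmodule_ne_bot K C')))
  exact (mem_moduleSocle K).2 (eq_trace_smul_top_of_mem_uniserial K hx.1 fun j _ hj =>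
    trace_mul_dualElt_of_ne K hC.symm hx.2 hj)

theorem uniserialSubmodule_le_jacobson (C : Γ.SpecialCycle V) :
    Γ.uniserialSubmodule K C 1 ≤ Module.jacobson (Γ.BCAlgebra K)ᵐᵒᵖ (Γ.proj K V) := by
  rw [jacobson_proj]
  exact uniserialSubmodule_le_projRad K C

theorem moduleSocle_le_jacobson :
    moduleSocle (Γ.BCAlgebra K)ᵐᵒᵖ (Γ.proj K V) ≤
      Module.jacobson (Γ.BCAlgebra K)ᵐᵒᵖ (Γ.proj K V) := by
  rw [jacobson_proj]
  intro x hx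
  obtain ⟨c, hc⟩ := (mem_moduleSocle K).1 hx
  rw [mem_projRad, hc, map_smul, top, coeffIdem_walkElt K V _ (Arrow.total_pos _), smul_zero]

/-! ### The heart -/

theorem heartImage_ne_bot (C : Γ.SpecialCycle V) :
    heartImage (Γ.BCAlgebra K)ᵐᵒᵖ (Γ.uniserialSubmodule K C 1) ≠ ⊥ := by
  intro h
  have h1 := prefixElt_mem K C one_pos
  have h2 : Submodule.Quotient.mk ⟨Γ.prefixElt K C 1, uniserialSubmodule_le_jacobson K C h1⟩ ∈
      heartImage (Γ.BCAlgebra K)ᵐᵒᵖ (Γ.uniserialSubmodule K C 1) := mem_heartImage.2 ⟨_, h1, rfl⟩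
  rw [h, Submodule.mem_bot, Submodule.Quotient.mk_eq_zero] at h2
  exact prefixElt_one_notMem_moduleSocle K C h2

theorem isUniserial_heartImage (C : Γ.SpecialCycle V) :
    IsUniserial (Γ.BCAlgebra K)ᵐᵒᵖ
      (heartImage (Γ.BCAlgebra K)ᵐᵒᵖ (Γ.uniserialSubmodule K C 1)) :=
  isUniserial_heartImage_of_forall fun _ hx _ hy => exists_smul_eq_of_mem_uniserial K hx hy

/-- Dual walks of positive length kill the socle, so pairing with them is well defined on the heart
and separates the image of U_1(C) from the sum of the others. -/
theorem isInternal_heartImage : DirectSum.IsInternal (fun C : Γ.SpecialCycle V =>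
    heartImage (Γ.BCAlgebra K)ᵐᵒᵖ (Γ.uniserialSubmodule K C 1)) := by
  rw [DirectSum.isInternal_submodule_iff_iSupIndep_and_iSup_eq_top]
  constructor
  · intro C
    rw [Submodule.disjoint_def]
    intro x hx hx'
    obtain ⟨z, hz, rfl⟩ := mem_heartImage.1 hx
    rw [iSup_subtype'] at hx'
    -- A representative w of the class built from the other cycles. It differs from z by a socle
    -- element, so z inherits its vanishing pairings and lies in the socle.
    have key : ∃ w : Module.jacobson (Γ.BCAlgebra K)ᵐᵒᵖ (Γ.proj K V),
        (∀ j, j < (C.arrow 0).total →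
          trace K (((w : Γ.proj K V) : Γ.BCAlgebra K) * dualElt K (C.arrow 0) j) = 0) ∧
        (Submodule.Quotient.mk w : ModuleHeart (Γ.BCAlgebra K)ᵐᵒᵖ (Γ.proj K V)) =
          Submodule.Quotient.mk z := by
      refine Submodule.iSup_induction _ (motive := fun x => ∃ w : Module.jacobson
        (Γ.BCAlgebra K)ᵐᵒᵖ (Γ.proj K V), (∀ j, j < (C.arrow 0).total →
          trace K (((w : Γ.proj K V) : Γ.BCAlgebra K) * dualElt K (C.arrow 0) j) = 0) ∧
        (Submodule.Quotient.mk w : ModuleHeart (Γ.BCAlgebra K)ᵐᵒᵖ (Γ.proj K V)) = x) hx' ?_ ?_ ?_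
      · intro C' x hx
        obtain ⟨w, hw, rfl⟩ := mem_heartImage.1 hx
        exact ⟨w, fun j hj => trace_mul_dualElt_of_ne K C'.2 hw hj, rfl⟩
      · exact ⟨0, fun j _ => by simp, rfl⟩
      · rintro _ _ ⟨w, hw, rfl⟩ ⟨w', hw', rfl⟩
        refine ⟨w + w', fun j hj => ?_, rfl⟩
        change trace K ((((w : Γ.proj K V) : Γ.BCAlgebra K) + ((w' : Γ.proj K V) :
          Γ.BCAlgebra K)) * _) = 0
        rw [add_mul, map_add, hw j hj, hw' j hj, add_zero]
    obtain ⟨w, hw, hwz⟩ := key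
    rw [Submodule.Quotient.eq] at hwz
    obtain ⟨c, hc⟩ := (mem_moduleSocle K).1 hwz
    rw [Submodule.Quotient.mk_eq_zero]
    refine (mem_moduleSocle K).2 (eq_trace_smul_top_of_mem_uniserial K hz fun j _ hj => ?_)
    have h1 : ((w : Γ.proj K V) : Γ.BCAlgebra K) - ((z : Γ.proj K V) : Γ.BCAlgebra K) =
      c • top K V := hc
    have h2 := hw j hj
    rw [sub_eq_iff_eq_add.1 h1, add_mul, smul_mul_assoc, top_mul_dualElt K V _ hj, smul_zero,
      zero_add] at h2
    exact h2
  · rw [eq_top_iff]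
    rintro x -
    obtain ⟨⟨z, hz⟩, rfl⟩ := Submodule.Quotient.mk_surjective _ x
    have hz' := hz
    rw [jacobson_proj, projRad_eq_iSup] at hz'
    induction hz' using Submodule.iSup_induction' with
    | mem C y hy => exact Submodule.mem_iSup_of_mem C (mem_heartImage.2 ⟨_, hy, rfl⟩)
    | zero => exact zero_mem _
    | add x y hx hy ihx ihy =>
      rw [← projRad_eq_iSup, ← jacobson_proj] at hx hy
      exact add_mem (ihx hx) (ihy hy)

end Modules

end BrauerConfiguration

theorem theorem3p9 {Γ₀ : Type*} {Γ₁ : Type*} [DecidableEq Γ₀] [Fintype Γ₁]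
    (K : Type*) [Field K] (Γ : BrauerConfiguration Γ₀ Γ₁) (hΓ : Γ.IsReduced) :
    -- `V ↦ P_V` is a bijection from polygons to isomorphism classes of indecomposable projectives
    ((∀ V : Γ₁, Module.Projective (Γ.BCAlgebra K)ᵐᵒᵖ (Γ.proj K V) ∧
        IsIndecomposableModule (Γ.BCAlgebra K)ᵐᵒᵖ (Γ.proj K V)) ∧
      (∀ V W : Γ₁, Nonempty (Γ.proj K V ≃ₗ[(Γ.BCAlgebra K)ᵐᵒᵖ] Γ.proj K W) → V = W) ∧
      (∀ (P : Type u) [AddCommGroup P] [Module (Γ.BCAlgebra K)ᵐᵒᵖ P],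
        Module.Projective (Γ.BCAlgebra K)ᵐᵒᵖ P → IsIndecomposableModule (Γ.BCAlgebra K)ᵐᵒᵖ P →
        ∃ V : Γ₁, Nonempty (P ≃ₗ[(Γ.BCAlgebra K)ᵐᵒᵖ] Γ.proj K V))) ∧
    ∀ V : Γ₁,
      -- the number `r` of special cycles at `v`
      ((∀ α ∈ Γ.polygon V, ¬ Γ.IsTruncated α) →
        Nat.card (Γ.SpecialCycle V) = (Γ.polygon V).card) ∧
      ((∃ α ∈ Γ.polygon V, Γ.IsTruncated α) →
        (Γ.polygon V).card = 2 ∧ Nat.card (Γ.SpecialCycle V) = 1) ∧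
      -- the modules `U_1(C)` are uniserial, with the expected bases
      (∀ C : Γ.SpecialCycle V,
        IsUniserial (Γ.BCAlgebra K)ᵐᵒᵖ (Γ.uniserialSubmodule K C 1) ∧
        LinearIndependent K (fun j : Fin (Γ.val C.vertex * Γ.mult C.vertex) =>
          Γ.prefixElt K C (j + 1)) ∧
        (Submodule.span K (Set.range fun j : Fin (Γ.val C.vertex * Γ.mult C.vertex) =>
            Γ.prefixElt K C (j + 1)) : Set (Γ.proj K V)) =
          Γ.uniserialSubmodule K C 1) ∧
      -- the radical is their sum
      Module.jacobson (Γ.BCAlgebra K)ᵐᵒᵖ (Γ.proj K V) =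
        ⨆ C : Γ.SpecialCycle V, Γ.uniserialSubmodule K C 1 ∧
      -- the socle is simple, and is the intersection of any two of them
      IsSimpleModule (Γ.BCAlgebra K)ᵐᵒᵖ (moduleSocle (Γ.BCAlgebra K)ᵐᵒᵖ (Γ.proj K V)) ∧
      (∀ C C' : Γ.SpecialCycle V, C ≠ C' →
        Γ.uniserialSubmodule K C 1 ⊓
            Γ.uniserialSubmodule K C' 1 =
          moduleSocle (Γ.BCAlgebra K)ᵐᵒᵖ (Γ.proj K V)) ∧
      -- the heart is the direct sum of their images, which are nonzero and uniserial
      moduleSocle (Γ.BCAlgebra K)ᵐᵒᵖ (Γ.proj K V) ≤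
        Module.jacobson (Γ.BCAlgebra K)ᵐᵒᵖ (Γ.proj K V) ∧
      DirectSum.IsInternal (fun C : Γ.SpecialCycle V =>
        heartImage (Γ.BCAlgebra K)ᵐᵒᵖ (Γ.uniserialSubmodule K C 1)) ∧
      (∀ C : Γ.SpecialCycle V,
        heartImage (Γ.BCAlgebra K)ᵐᵒᵖ (Γ.uniserialSubmodule K C 1) ≠ ⊥ ∧
        IsUniserial (Γ.BCAlgebra K)ᵐᵒᵖ
          (heartImage (Γ.BCAlgebra K)ᵐᵒᵖ (Γ.uniserialSubmodule K C 1))) := by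
  refine ⟨⟨fun V => ⟨BrauerConfiguration.projective_proj K V,
    BrauerConfiguration.isIndecomposable_proj K V⟩, ?_, ?_⟩, fun V => ?_⟩
  · rintro V W ⟨φ⟩
    exact BrauerConfiguration.eq_of_proj_equiv K φ
  · intro P _ _ hP hind
    exact BrauerConfiguration.exists_equiv_proj K hP hind
  · refine ⟨BrauerConfiguration.card_specialCycle_of_forall, fun h => ?_, fun C =>
      ⟨BrauerConfiguration.isUniserial_uniserialSubmodule K C,
        BrauerConfiguration.linearIndependent_prefixElt K C,
        BrauerConfiguration.span_prefixElt K C⟩, ?_,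
      BrauerConfiguration.isSimpleModule_moduleSocle K, fun C C' hC =>
      BrauerConfiguration.uniserialSubmodule_inf K hC,
      BrauerConfiguration.moduleSocle_le_jacobson K,
      BrauerConfiguration.isInternal_heartImage K, fun C =>
      ⟨BrauerConfiguration.heartImage_ne_bot K C, BrauerConfiguration.isUniserial_heartImage K C⟩⟩
    · obtain ⟨α, hα, hαt⟩ := h
      -- Reducedness enters only here, to make a polygon with a truncated vertex a 2-gon.
      have h2 := hΓ V α hα hαt
      exact ⟨h2, BrauerConfiguration.card_specialCycle_of_exists h2 ⟨α, hα, hαt⟩⟩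
    · rw [BrauerConfiguration.jacobson_proj, BrauerConfiguration.projRad_eq_iSup]
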